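/- Let $H$ be a separable Hilbert space over $\mathbb K\in\{\mathbb R,\mathbb C\}$ and let $A:H\to H$ be a trace-class operator. For $k\ge 0$ let $\Lambda^k(A)$ be the $k$-th exterior power of $A$, i.e. the bounded operator on the Hilbert space $\Lambda^k(H)$ (the completion of the algebraic exterior power with respect to $\langle x_1\wedge\dots\wedge x_k,\,y_1\wedge\dots\wedge y_k\rangle=\det(\langle x_i,y_j\rangle)_{i,j}$) determined by $\Lambda^k(A)(x_1\wedge\dots\wedge x_k)=Ax_1\wedge\dots\wedge Ax_k$. Put $$\rho:=\limsup_{k\to\infty}\frac{k\ln k}{-\ln\left|\operatorname{tr}\Lambda^k(A)\right|}\in[-\infty,+\infty],$$ where the quotient is read as $0$ when $\operatorname{tr}\Lambda^k(A)=0$. Let $\{\lambda_i\}$ be the reciprocals of the nonzero eigenvalues $\lambda_i^{-1}\in\mathbb K$ of $A$, each repeated according to the algebraic multiplicity $\dim\bigcup_{n}\ker(A-\lambda_i^{-1}I)^n$ of the eigenvalue. Then these multiplicities are finite and, for every real $s>\rho$, $$\sum_i\frac{1}{|\lambda_i|^{s}}<\infty .$$ -/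

import Mathlib

open scoped ComplexConjugate

noncomputable section

namespace HilbertExt

variable {𝕜 : Type*} [RCLike 𝕜] {H : Type*} [NormedAddCommGroup H] [InnerProductSpace 𝕜 H]

/-! ### A determinant identity of Cauchy–Binet type -/

theorem factorial_mul_det {ι : Type*} [Fintype ι] {k : ℕ} (c : ι → 𝕜) (a b : Fin k → ι → 𝕜) :
    (k.factorial : 𝕜) * (Matrix.of fun i j => ∑ l, a i l * c l * b j l).det =
      ∑ f : Fin k → ι, (∏ j, c (f j)) * ((Matrix.of fun i j => a i (f j)).det *
        (Matrix.of fun i j => b i (f j)).det) := by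
  classical
  set M : Matrix (Fin k) (Fin k) 𝕜 := Matrix.of fun i j => ∑ l, a i l * c l * b j l with hM
  have h1 : ∀ τ : Equiv.Perm (Fin k),
      ((Equiv.Perm.sign τ : ℤ) : 𝕜) * (M.submatrix id τ).det = M.det := by
    intro τ
    rw [Matrix.det_permute']
    rcases Int.units_eq_one_or (Equiv.Perm.sign τ) with h | h <;> simp [h]
  have h2 : (k.factorial : 𝕜) * M.det =
      ∑ τ : Equiv.Perm (Fin k), ((Equiv.Perm.sign τ : ℤ) : 𝕜) * (M.submatrix id τ).det := by
    simp [h1, Fintype.card_perm]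
  have h3 : ∀ σ τ : Equiv.Perm (Fin k), ∏ j, M (σ j) (τ j) =
      ∑ f : Fin k → ι, (∏ j, c (f j)) * ((∏ j, a (σ j) (f j)) * ∏ j, b (τ j) (f j)) := by
    intro σ τ
    simp only [hM, Matrix.of_apply]
    rw [Finset.prod_univ_sum, Fintype.piFinset_univ]
    refine Finset.sum_congr rfl fun f _ => ?_
    rw [← Finset.prod_mul_distrib, ← Finset.prod_mul_distrib]
    exact Finset.prod_congr rfl fun j _ => by ring
  rw [h2]
  simp only [Matrix.det_apply', Matrix.submatrix_apply, id, Matrix.of_apply, h3]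
  simp only [Finset.mul_sum, Finset.sum_mul]
  rw [Finset.sum_congr rfl fun τ _ => Finset.sum_comm, Finset.sum_comm]
  refine Finset.sum_congr rfl fun f _ => ?_
  refine Finset.sum_congr rfl fun τ _ => ?_
  refine Finset.sum_congr rfl fun σ _ => by ring

/-! ### The inner product on the algebraic exterior power -/

/-- The functional `ω ↦ ⟪x₁ ∧ ⋯ ∧ x_k, ω⟫` on `⋀^k H`. -/
def wedgeFunctional {k : ℕ} (x : Fin k → H) : ⋀[𝕜]^k H →ₗ[𝕜] 𝕜 :=
  exteriorPower.pairingDual 𝕜 H k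
    (exteriorPower.ιMulti 𝕜 k fun i => (innerₛₗ 𝕜 (x i) : H →ₗ[𝕜] 𝕜))

theorem wedgeFunctional_ιMulti {k : ℕ} (x y : Fin k → H) :
    wedgeFunctional x (exteriorPower.ιMulti 𝕜 k y) =
      (Matrix.of fun i j => inner 𝕜 (x i) (y j)).det := by
  rw [wedgeFunctional, exteriorPower.pairingDual_ιMulti_ιMulti, ← Matrix.det_transpose]
  rfl

/-- The linear functional `η ↦ conj ⟪η, ω⟫` on `⋀^k H`. -/
def conjInner {k : ℕ} (ω : ⋀[𝕜]^k H) : ⋀[𝕜]^k H →ₗ[𝕜] 𝕜 :=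
  exteriorPower.alternatingMapLinearEquiv
    { toFun := fun x => conj (wedgeFunctional x ω)
      map_update_add' := by
        intro _ x i a b
        have := (exteriorPower.ιMulti 𝕜 k (M := Module.Dual 𝕜 H)).map_update_add
          (fun i => (innerₛₗ 𝕜 (x i) : H →ₗ[𝕜] 𝕜)) i (innerₛₗ 𝕜 a) (innerₛₗ 𝕜 b)
        have e : ∀ v : H, (fun j => (innerₛₗ 𝕜 (Function.update x i v j) : H →ₗ[𝕜] 𝕜)) =
            Function.update (fun j => (innerₛₗ 𝕜 (x j) : H →ₗ[𝕜] 𝕜)) i (innerₛₗ 𝕜 v) := by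
          intro v; ext j w; by_cases h : j = i
          · subst h; simp
          · simp [h]
        have e' : (innerₛₗ 𝕜 (a + b) : H →ₗ[𝕜] 𝕜) = innerₛₗ 𝕜 a + innerₛₗ 𝕜 b := map_add _ _ _
        simp only [wedgeFunctional] at this ⊢
        rw [e, e, e, e', this]
        simp
      map_update_smul' := by
        intro _ x i r a
        have := (exteriorPower.ιMulti 𝕜 k (M := Module.Dual 𝕜 H)).map_update_smul
          (fun i => (innerₛₗ 𝕜 (x i) : H →ₗ[𝕜] 𝕜)) i (conj r) (innerₛₗ 𝕜 a)
        have e : ∀ v : H, (fun j => (innerₛₗ 𝕜 (Function.update x i v j) : H →ₗ[𝕜] 𝕜)) =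
            Function.update (fun j => (innerₛₗ 𝕜 (x j) : H →ₗ[𝕜] 𝕜)) i (innerₛₗ 𝕜 v) := by
          intro v; ext j w; by_cases h : j = i
          · subst h; simp
          · simp [h]
        have e' : (innerₛₗ 𝕜 (r • a) : H →ₗ[𝕜] 𝕜) = conj r • innerₛₗ 𝕜 a := by
          ext w; simp
        simp only [wedgeFunctional] at this ⊢
        rw [e, e, e', this]
        simp
      map_eq_zero_of_eq' := by
        intro x i j hij hne
        have := (exteriorPower.ιMulti 𝕜 k (M := Module.Dual 𝕜 H)).map_eq_zero_of_eq
          (fun i => (innerₛₗ 𝕜 (x i) : H →ₗ[𝕜] 𝕜)) (i := i) (j := j) (by simp [hij]) hne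
        simp [wedgeFunctional, this] }

theorem conjInner_ιMulti {k : ℕ} (ω : ⋀[𝕜]^k H) (x : Fin k → H) :
    conjInner ω (exteriorPower.ιMulti 𝕜 k x) = conj (wedgeFunctional x ω) := by
  simp [conjInner]

theorem conjInner_add {k : ℕ} (ω ω' : ⋀[𝕜]^k H) :
    conjInner (ω + ω') = conjInner ω + conjInner ω' := by
  apply exteriorPower.linearMap_ext
  ext x
  simp [conjInner_ιMulti]

theorem conjInner_smul {k : ℕ} (r : 𝕜) (ω : ⋀[𝕜]^k H) :
    conjInner (r • ω) = conj r • conjInner ω := by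
  apply exteriorPower.linearMap_ext
  ext x
  simp [conjInner_ιMulti]

theorem exists_finsupp {k : ℕ} (ω : ⋀[𝕜]^k H) :
    ∃ c : (Fin k → H) →₀ 𝕜, ω = ∑ x ∈ c.support, c x • exteriorPower.ιMulti 𝕜 k x := by
  have : ω ∈ Submodule.span 𝕜 (Set.range (exteriorPower.ιMulti 𝕜 k (M := H))) := by
    rw [exteriorPower.ιMulti_span]; trivial
  obtain ⟨c, hc⟩ := Finsupp.mem_span_range_iff_exists_finsupp.1 this
  exact ⟨c, hc.symm⟩

theorem conjInner_symm {k : ℕ} (ω η : ⋀[𝕜]^k H) :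
    conj (conjInner ω η) = conjInner η ω := by
  have key : ∀ x : Fin k → H, ∀ ω : ⋀[𝕜]^k H,
      conjInner (exteriorPower.ιMulti 𝕜 k x) ω = wedgeFunctional x ω := by
    intro x ω
    revert ω
    rw [← LinearMap.ext_iff]
    apply exteriorPower.linearMap_ext
    ext y
    simp only [LinearMap.compAlternatingMap_apply, conjInner_ιMulti, wedgeFunctional_ιMulti]
    rw [RingHom.map_det, ← Matrix.det_transpose]
    congr 1
    ext i j
    simp
  obtain ⟨c, rfl⟩ := exists_finsupp η
  have hsum : ∀ s : Finset (Fin k → H),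
      conjInner (∑ x ∈ s, c x • exteriorPower.ιMulti 𝕜 k x) =
        ∑ x ∈ s, conj (c x) • conjInner (exteriorPower.ιMulti 𝕜 k x) := by
    classical
    intro s
    induction s using Finset.induction_on with
    | empty =>
      have := conjInner_smul (0 : 𝕜) (0 : ⋀[𝕜]^k H)
      simpa using this
    | insert a s ha ih => rw [Finset.sum_insert ha, Finset.sum_insert ha, conjInner_add,
        conjInner_smul, ih]
  rw [hsum]
  simp [conjInner_ιMulti, key]

/-- The key identity: a Hermitian form on a finite-dimensional space that is diagonal in an
orthonormal basis induces a diagonal form on exterior powers. -/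
theorem sum_sum_det {ι X : Type*} [Fintype ι] {k : ℕ} (s : Finset X) (z : X → 𝕜)
    (lam : ι → ℝ) (p : X → Fin k → ι → 𝕜) :
    (k.factorial : 𝕜) * (∑ x ∈ s, ∑ y ∈ s, conj (z x) * z y *
      (Matrix.of fun i j => ∑ l, conj (p x i l) * (lam l : 𝕜) * p y j l).det) =
    ((∑ f : Fin k → ι, (∏ j, lam (f j)) *
      ‖∑ x ∈ s, z x * (Matrix.of fun i j => p x i (f j)).det‖ ^ 2 : ℝ) : 𝕜) := by
  have h1 : ∀ x y, (k.factorial : 𝕜) * (conj (z x) * z y *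
      (Matrix.of fun i j => ∑ l, conj (p x i l) * (lam l : 𝕜) * p y j l).det) =
      ∑ f : Fin k → ι, (∏ j, (lam (f j) : 𝕜)) *
        (conj (z x * (Matrix.of fun i j => p x i (f j)).det) *
          (z y * (Matrix.of fun i j => p y i (f j)).det)) := by
    intro x y
    rw [mul_left_comm, factorial_mul_det (fun l => (lam l : 𝕜)) (fun i l => conj (p x i l)) (p y),
      Finset.mul_sum]
    refine Finset.sum_congr rfl fun f _ => ?_
    have : (Matrix.of fun i j => conj (p x i (f j))).det =
        conj (Matrix.of fun i j => p x i (f j)).det := by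
      rw [RingHom.map_det]; rfl
    rw [this, map_mul]
    ring
  rw [Finset.mul_sum]
  simp only [Finset.mul_sum, h1]
  rw [Finset.sum_congr rfl fun x _ => Finset.sum_comm, Finset.sum_comm]
  push_cast
  refine Finset.sum_congr rfl fun f _ => ?_
  rw [← RCLike.conj_mul, map_sum, Finset.sum_mul_sum, Finset.mul_sum]
  refine Finset.sum_congr rfl fun x _ => ?_
  rw [Finset.mul_sum]

theorem conjInner_sum {k : ℕ} (s : Finset (Fin k → H)) (z : (Fin k → H) → 𝕜)
    (x' : (Fin k → H) → Fin k → H) :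
    conj (conjInner (∑ x ∈ s, z x • exteriorPower.ιMulti 𝕜 k (x' x))
      (∑ x ∈ s, z x • exteriorPower.ιMulti 𝕜 k (x' x))) =
    ∑ x ∈ s, ∑ y ∈ s, conj (z x) * z y *
      (Matrix.of fun i j => inner 𝕜 (x' x i) (x' y j)).det := by
  simp only [map_sum, map_smul, conjInner_ιMulti, wedgeFunctional_ιMulti, smul_eq_mul, map_mul,
    RCLike.conj_conj, Finset.mul_sum, mul_assoc]

theorem exists_finite_model {k : ℕ} (s : Finset (Fin k → H)) :
    ∃ V : Submodule 𝕜 H, FiniteDimensional 𝕜 V ∧ ∀ x ∈ s, ∀ i, x i ∈ V := by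
  refine ⟨Submodule.span 𝕜 (⋃ x ∈ s, Set.range x), ?_, fun x hx i => ?_⟩
  · refine FiniteDimensional.span_of_finite 𝕜 ?_
    exact s.finite_toSet.biUnion fun x _ => Set.finite_range x
  · exact Submodule.subset_span (Set.mem_biUnion hx ⟨i, rfl⟩)

/-- Simultaneous diagonalization: on a finite-dimensional subspace `V`, both `⟪v, w⟫` and
`⟪A v, A w⟫` are diagonal in a suitable orthonormal family. -/
theorem exists_diagonal [CompleteSpace H] (A : H →L[𝕜] H) (V : Submodule 𝕜 H)
    [FiniteDimensional 𝕜 V] :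
    ∃ (n : ℕ) (e : Fin n → H) (lam : Fin n → ℝ), (∀ l, 0 ≤ lam l) ∧ (∀ l, lam l ≤ ‖A‖ ^ 2) ∧
      (∀ v ∈ V, ∀ w ∈ V, inner 𝕜 v w =
        ∑ l, conj (inner 𝕜 (e l) v) * ((1 : ℝ) : 𝕜) * inner 𝕜 (e l) w) ∧
      (∀ v ∈ V, ∀ w ∈ V, inner 𝕜 (A v) (A w) =
        ∑ l, conj (inner 𝕜 (e l) v) * (lam l : 𝕜) * inner 𝕜 (e l) w) := by
  have : CompleteSpace V := FiniteDimensional.complete 𝕜 V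
  set AV : V →L[𝕜] H := A ∘L V.subtypeL with hAV
  set T : V →L[𝕜] V := (ContinuousLinearMap.adjoint AV) ∘L AV with hT
  have hTin : ∀ v w : V, inner 𝕜 v (T w) = inner 𝕜 (A v) (A w) := by
    intro v w
    rw [hT, ContinuousLinearMap.comp_apply, ContinuousLinearMap.adjoint_inner_right]
    rfl
  have hTin' : ∀ v w : V, inner 𝕜 (T v) w = inner 𝕜 (A v) (A w) := by
    intro v w
    rw [hT, ContinuousLinearMap.comp_apply, ContinuousLinearMap.adjoint_inner_left]
    rfl
  have hsym : (T : V →ₗ[𝕜] V).IsSymmetric := by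
    intro v w
    exact (hTin' v w).trans (hTin v w).symm
  set e := hsym.eigenvectorBasis rfl with he
  set lam := hsym.eigenvalues rfl with hlam
  have hTe : ∀ l, T (e l) = (lam l : 𝕜) • e l := fun l => hsym.apply_eigenvectorBasis rfl l
  have hlam_eq : ∀ l, lam l = ‖A (e l)‖ ^ 2 := by
    intro l
    have h := hTin (e l) (e l)
    rw [hTe, inner_smul_right, inner_self_eq_norm_sq_to_K, inner_self_eq_norm_sq_to_K,
      e.orthonormal.1 l] at h
    have h' : ((lam l : ℝ) : 𝕜) = ((‖A (e l)‖ ^ 2 : ℝ) : 𝕜) := by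
      push_cast
      simpa using h
    exact RCLike.ofReal_injective h'
  refine ⟨_, fun l => (e l : H), lam, fun l => ?_, fun l => ?_, ?_, ?_⟩
  · rw [hlam_eq]; positivity
  · rw [hlam_eq]
    have h := A.le_opNorm (e l : H)
    have h1 : ‖(e l : H)‖ = 1 := e.orthonormal.1 l
    rw [h1, mul_one] at h
    gcongr
  · intro v hv w hw
    have h := e.sum_inner_mul_inner ⟨v, hv⟩ ⟨w, hw⟩
    simp only [Submodule.coe_inner] at h
    rw [← h]
    exact Finset.sum_congr rfl fun l _ => by simp
  · intro v hv w hw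
    have h := e.sum_inner_mul_inner ⟨v, hv⟩ (T ⟨w, hw⟩)
    rw [hTin] at h
    rw [← h]
    refine Finset.sum_congr rfl fun l _ => ?_
    have h2 : inner 𝕜 (e l) (T ⟨w, hw⟩) = (lam l : 𝕜) * inner 𝕜 (e l) ⟨w, hw⟩ := by
      have := hsym (e l) ⟨w, hw⟩
      rw [ContinuousLinearMap.coe_coe, hTe, inner_smul_left, RCLike.conj_ofReal] at this
      exact this.symm
    rw [h2]
    simp [mul_assoc]

/-- The Gram form is nonnegative, and applying a bounded operator `A` to the factors increases it
at most by the factor `‖A‖ ^ (2 * k)`. -/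
theorem conjInner_self_aux [CompleteSpace H] {k : ℕ} (A : H →L[𝕜] H) (ω : ⋀[𝕜]^k H) :
    0 ≤ RCLike.re (conj (conjInner ω ω)) ∧
    RCLike.re (conj (conjInner (exteriorPower.map k (A : H →ₗ[𝕜] H) ω)
      (exteriorPower.map k (A : H →ₗ[𝕜] H) ω))) ≤
      (‖A‖ ^ 2) ^ k * RCLike.re (conj (conjInner ω ω)) := by
  obtain ⟨z, hz⟩ := exists_finsupp ω
  obtain ⟨V, hV, hmem⟩ := exists_finite_model (𝕜 := 𝕜) z.support
  obtain ⟨n, e, lam, h0, hle, hid, hA⟩ := exists_diagonal A V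
  have key : ∀ (B : H →L[𝕜] H) (mu : Fin n → ℝ),
      (∀ v ∈ V, ∀ w ∈ V, inner 𝕜 (B v) (B w) =
        ∑ l, conj (inner 𝕜 (e l) v) * (mu l : 𝕜) * inner 𝕜 (e l) w) →
      (k.factorial : ℝ) * RCLike.re (conj (conjInner (exteriorPower.map k (B : H →ₗ[𝕜] H) ω)
        (exteriorPower.map k (B : H →ₗ[𝕜] H) ω))) =
      ∑ f : Fin k → Fin n, (∏ j, mu (f j)) *
        ‖∑ x ∈ z.support, z x * (Matrix.of fun i j => inner 𝕜 (e (f j)) (x i)).det‖ ^ 2 := by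
    intro B mu hB
    have h1 : exteriorPower.map k (B : H →ₗ[𝕜] H) ω =
        ∑ x ∈ z.support, z x • exteriorPower.ιMulti 𝕜 k (fun i => B (x i)) := by
      conv_lhs => rw [hz]
      rw [map_sum]
      refine Finset.sum_congr rfl fun x _ => ?_
      rw [map_smul, exteriorPower.map_apply_ιMulti]
      rfl
    have h2 := sum_sum_det (k := k) z.support z mu (fun x i l => inner 𝕜 (e l) (x i))
    have h3 : (k.factorial : 𝕜) *
        conj (conjInner (exteriorPower.map k (B : H →ₗ[𝕜] H) ω)
          (exteriorPower.map k (B : H →ₗ[𝕜] H) ω)) =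
        ((∑ f : Fin k → Fin n, (∏ j, mu (f j)) * ‖∑ x ∈ z.support,
          z x * (Matrix.of fun i j => inner 𝕜 (e (f j)) (x i)).det‖ ^ 2 : ℝ) : 𝕜) := by
      rw [h1, conjInner_sum z.support z (fun x i => B (x i)), ← h2]
      congr 1
      refine Finset.sum_congr rfl fun x hx => Finset.sum_congr rfl fun y hy => ?_
      congr 3
      ext i j
      exact hB _ (hmem x hx i) _ (hmem y hy j)
    have h4 := congrArg RCLike.re h3
    rw [RCLike.ofReal_re] at h4
    have h5 : ((k.factorial : ℕ) : 𝕜) = ((k.factorial : ℝ) : 𝕜) := by simp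
    rw [← h4, h5, RCLike.re_ofReal_mul]
  have hk : (0 : ℝ) < k.factorial := by exact_mod_cast k.factorial_pos
  have k1 := key (ContinuousLinearMap.id 𝕜 H) (fun _ => 1) hid
  have hmapid : exteriorPower.map k ((ContinuousLinearMap.id 𝕜 H : H →L[𝕜] H) : H →ₗ[𝕜] H) ω
      = ω := by
    rw [ContinuousLinearMap.coe_id, exteriorPower.map_id]; rfl
  rw [hmapid] at k1
  have kA := key A lam hA
  constructor
  · refine nonneg_of_mul_nonneg_right ?_ hk
    rw [k1]
    positivity
  · refine le_of_mul_le_mul_left ?_ hk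
    rw [kA, mul_left_comm, k1, Finset.mul_sum]
    refine Finset.sum_le_sum fun f _ => ?_
    rw [Finset.prod_const_one, one_mul]
    refine mul_le_mul_of_nonneg_right ?_ (by positivity)
    calc ∏ j, lam (f j) ≤ ∏ _j : Fin k, ‖A‖ ^ 2 :=
          Finset.prod_le_prod (fun j _ => h0 _) (fun j _ => hle _)
      _ = (‖A‖ ^ 2) ^ k := by simp

/-! ### The Hilbert space exterior power -/

/-- The algebraic exterior power `⋀^k H`, as a type of its own that carries the inner product
determined by `⟪x₁ ∧ ⋯ ∧ x_k, y₁ ∧ ⋯ ∧ y_k⟫ = det (⟪x_i, y_j⟫)`. -/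
def AlgExteriorPower (𝕜 : Type*) [RCLike 𝕜] (H : Type*) [NormedAddCommGroup H]
    [InnerProductSpace 𝕜 H] (k : ℕ) : Type _ := ⋀[𝕜]^k H

instance (k : ℕ) : AddCommGroup (AlgExteriorPower 𝕜 H k) :=
  inferInstanceAs (AddCommGroup (⋀[𝕜]^k H))

instance (k : ℕ) : Module 𝕜 (AlgExteriorPower 𝕜 H k) :=
  inferInstanceAs (Module 𝕜 (⋀[𝕜]^k H))

/-- The inner product of `η` and `ω` is `conj (conjInner ω η)`. -/
@[reducible] def exteriorCore [CompleteSpace H] (k : ℕ) :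
    PreInnerProductSpace.Core 𝕜 (AlgExteriorPower 𝕜 H k) where
  inner η ω := conj (conjInner (k := k) (H := H) ω η)
  conj_inner_symm η ω :=
    congrArg conj (conjInner_symm (k := k) (H := H) η ω)
  re_inner_nonneg ω := (conjInner_self_aux (0 : H →L[𝕜] H) (k := k) ω).1
  add_left a b c := by
    exact (congrArg conj (map_add (conjInner (k := k) (H := H) c) a b)).trans (map_add _ _ _)
  smul_left a b r := by
    exact (congrArg conj (map_smul (conjInner (k := k) (H := H) b) r a)).trans (map_mul _ _ _)

instance [CompleteSpace H] (k : ℕ) : SeminormedAddCommGroup (AlgExteriorPower 𝕜 H k) :=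
  @InnerProductSpace.Core.toSeminormedAddCommGroup 𝕜 _ _ _ _ (exteriorCore k)

instance [CompleteSpace H] (k : ℕ) : InnerProductSpace 𝕜 (AlgExteriorPower 𝕜 H k) :=
  InnerProductSpace.ofCore (exteriorCore k)

/-- The decomposable element `x₁ ∧ ⋯ ∧ x_k`. -/
def wedge {k : ℕ} (x : Fin k → H) : AlgExteriorPower 𝕜 H k := exteriorPower.ιMulti 𝕜 k x

theorem inner_wedge_wedge [CompleteSpace H] {k : ℕ} (x y : Fin k → H) :
    inner 𝕜 (wedge x : AlgExteriorPower 𝕜 H k) (wedge y) =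
      (Matrix.of fun i j => inner 𝕜 (x i) (y j)).det := by
  change conj (conjInner (exteriorPower.ιMulti 𝕜 k y) (exteriorPower.ιMulti 𝕜 k x)) = _
  rw [conjInner_ιMulti, RCLike.conj_conj, wedgeFunctional_ιMulti]

/-- The map `x₁ ∧ ⋯ ∧ x_k ↦ A x₁ ∧ ⋯ ∧ A x_k` on the algebraic exterior power. -/
def algExteriorMap [CompleteSpace H] (k : ℕ) (A : H →L[𝕜] H) :
    AlgExteriorPower 𝕜 H k →L[𝕜] AlgExteriorPower 𝕜 H k :=
  LinearMap.mkContinuous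
    (exteriorPower.map k (A : H →ₗ[𝕜] H) :
      AlgExteriorPower 𝕜 H k →ₗ[𝕜] AlgExteriorPower 𝕜 H k) (‖A‖ ^ k) (by
    intro ω
    have h := (conjInner_self_aux A (k := k) ω).2
    have hn : ∀ η : AlgExteriorPower 𝕜 H k,
        RCLike.re (conj (conjInner (k := k) (H := H) η η)) = ‖η‖ ^ 2 := fun η =>
      (norm_sq_eq_re_inner (𝕜 := 𝕜) η).symm
    erw [hn, hn] at h
    refine abs_le_of_sq_le_sq' ?_ (by positivity) |>.2
    rw [mul_pow, ← pow_mul, mul_comm k 2, pow_mul]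
    exact h)

/-- The exterior power `Λ^k(H)` of a Hilbert space: the completion of the algebraic one. -/
abbrev ExteriorPower (𝕜 : Type*) [RCLike 𝕜] (H : Type*) [NormedAddCommGroup H]
    [InnerProductSpace 𝕜 H] [CompleteSpace H] (k : ℕ) : Type _ :=
  UniformSpace.Completion (AlgExteriorPower 𝕜 H k)

/-- The exterior power `Λ^k(A)` of a bounded operator: the bounded operator on `Λ^k(H)` with
`Λ^k(A) (x₁ ∧ ⋯ ∧ x_k) = A x₁ ∧ ⋯ ∧ A x_k`. -/
def exteriorMap [CompleteSpace H] (k : ℕ) (A : H →L[𝕜] H) :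
    ExteriorPower 𝕜 H k →L[𝕜] ExteriorPower 𝕜 H k :=
  (algExteriorMap k A).completion

theorem exteriorMap_wedge [CompleteSpace H] {k : ℕ} (A : H →L[𝕜] H) (x : Fin k → H) :
    exteriorMap k A ((wedge x : AlgExteriorPower 𝕜 H k) : ExteriorPower 𝕜 H k) =
      ((wedge fun i => A (x i) : AlgExteriorPower 𝕜 H k) : ExteriorPower 𝕜 H k) := by
  rw [exteriorMap, ContinuousLinearMap.completion_apply_coe]
  congr 1
  exact exteriorPower.map_apply_ιMulti (A : H →ₗ[𝕜] H) x

/-! ### Trace-class operators, traces and eigenvalues -/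

/-- `A` is trace class: its absolute value `P = |A|`, the positive operator with `P² = A* A`, has
a convergent sum `∑ ⟪P b_i, b_i⟫` in some Hilbert basis (equivalently, in every one). -/
def IsTraceClass [CompleteSpace H] (A : H →L[𝕜] H) : Prop :=
  ∃ P : H →L[𝕜] H, P.IsPositive ∧ P ∘L P = (ContinuousLinearMap.adjoint A) ∘L A ∧
    ∃ (w : Set H) (b : HilbertBasis w 𝕜 H), Summable fun i => RCLike.re (inner 𝕜 (P (b i)) (b i))

/-- The trace `∑ ⟪b_i, A b_i⟫` of an operator, computed in a chosen Hilbert basis; for a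
trace-class operator the sum converges absolutely and does not depend on the basis. -/
def opTrace [CompleteSpace H] (A : H →L[𝕜] H) : 𝕜 :=
  ∑' i, inner 𝕜 ((exists_hilbertBasis 𝕜 H).choose_spec.choose i)
    (A ((exists_hilbertBasis 𝕜 H).choose_spec.choose i))

/-- The generalized eigenspace `⋃ₙ ker (A - μ)ⁿ`, whose dimension is the algebraic multiplicity
of `μ`. -/
def genEigenspace (A : H →L[𝕜] H) (μ : 𝕜) : Submodule 𝕜 H :=
  Module.End.maxGenEigenspace (A : H →ₗ[𝕜] H) μ

/-- The characteristic values of `A`: the reciprocals of its nonzero eigenvalues. -/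
def charValues (A : H →L[𝕜] H) : Set 𝕜 :=
  {z | z ≠ 0 ∧ Module.End.HasEigenvalue (A : H →ₗ[𝕜] H) z⁻¹}

/-- The number `limsup n ln n / (-ln |a n|)`, in the extended reals; the quotient is `0` when
`a n = 0`, as `-ln 0 = +∞`. -/
def coeffOrder (a : ℕ → 𝕜) : EReal :=
  Filter.limsup (fun n : ℕ => (((n : ℝ) * Real.log n / (-Real.log ‖a n‖) : ℝ) : EReal))
    Filter.atTop

end HilbertExt

end

/-!
A trace class operator `A` is nuclear: `A x = ∑ ⟪φ l, x⟫ ψ l` with `∑ ‖φ l‖ ‖ψ l‖ < ∞`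
(`IsTraceClass.isNuclear`). By the Cauchy–Binet formula the exterior powers `Λ^k(A)` are nuclear as
well, and their traces are given by Fredholm's formula
`tr Λ^k(A) = (1 / k!) ∑_f det ⟪φ (f i), ψ (f j)⟫`, the sum being over all `k`-tuples `f` of indices
(`IsNuclearRep.opTrace_exteriorMap`). Hadamard's inequality bounds them by `T ^ k / k!`, so that
`det (1 + z A) = ∑ tr Λ^k(A) z ^ k` is an entire function of `z`. Real scalars are embedded in `ℂ`
for this purpose.

If `v` is an eigenvector of `A` with eigenvalue `μ`, a representation of `A` adapted to `v` shows
that `det (1 + z A) = (1 + μ z) det (1 + z A')`, with `A'` the compression of `A` to the orthogonal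
complement of `v` (`IsNuclear.split_eigenvector`). Repeating this along a flag of invariant
subspaces made of generalized eigenvectors gives `det (1 + z A) = ∏ (1 + μ z) · g z` with `g` entire
and `g 0 = 1`, where each `μ` may be taken as often as its algebraic multiplicity allows
(`EigenFlag.exists_compression`, `exists_eigenFlag_of_finset`). Only this divisibility of the
determinant by the eigenvalue factors is needed, not that it has no other zeros.

The hypothesis on the traces means that `|tr Λ^k(A)| ≤ C k ^ (-k / t)` for some `t < s`, hence that
the determinant grows at most like `exp (c |z| ^ t)`. By an inequality of Jensen type
(`prod_mul_norm_le_of_factorization`) the number of reciprocal eigenvalues of absolute value at most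
`r`, counted with multiplicity, is then at most `K (1 + r ^ t)`. This bounds the multiplicities, and
a dyadic summation (`summable_of_counting`) gives the convergence of `∑ |z| ^ (-s)`.
-/

noncomputable section

open scoped ComplexConjugate Topology
open Filter

namespace HilbertExt

universe u

section Representation

variable {𝕜 : Type*} [RCLike 𝕜] {H : Type u} [NormedAddCommGroup H] [InnerProductSpace 𝕜 H]

/-! ### Nuclear representations and their traces -/

/-- The families `φ`, `ψ` represent `A` as an absolutely convergent sum `∑ ⟪φ l, ·⟫ ψ l` of
operators of rank at most one. -/
structure IsNuclearRep {ι E : Type*} [NormedAddCommGroup E] [InnerProductSpace 𝕜 E]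
    (A : E →L[𝕜] E) (φ ψ : ι → E) : Prop where
  summable : Summable fun l => ‖φ l‖ * ‖ψ l‖
  hasSum : ∀ x, HasSum (fun l => inner 𝕜 (φ l) x • ψ l) (A x)

/-- A consequence of Bessel's inequality. -/
theorem sum_norm_inner_mul_norm_inner_le {E w : Type*} [NormedAddCommGroup E]
    [InnerProductSpace 𝕜 E] {b : w → E} (hb : Orthonormal 𝕜 b) (x y : E) (s : Finset w) :
    ∑ i ∈ s, ‖inner 𝕜 x (b i) * inner 𝕜 (b i) y‖ ≤ ‖x‖ * ‖y‖ := by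
  have h1 := Finset.sum_mul_sq_le_sq_mul_sq s (fun i => ‖inner 𝕜 (b i) x‖)
    (fun i => ‖inner 𝕜 (b i) y‖)
  have h2 : (∑ i ∈ s, ‖inner 𝕜 (b i) x‖ * ‖inner 𝕜 (b i) y‖) ^ 2 ≤ (‖x‖ * ‖y‖) ^ 2 := by
    refine h1.trans ?_
    rw [mul_pow]
    gcongr
    · exact hb.sum_inner_products_le x
    · exact hb.sum_inner_products_le y
  have h3 := abs_le_of_sq_le_sq' h2 (by positivity) |>.2
  refine le_trans (le_of_eq ?_) h3
  refine Finset.sum_congr rfl fun i _ => ?_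
  rw [norm_mul, norm_inner_symm]

/-- In every Hilbert basis the trace of a nuclear operator is the sum of the traces of the rank
one operators that represent it. -/
theorem IsNuclearRep.tsum_inner_eq {ι E w : Type*} [NormedAddCommGroup E]
    [InnerProductSpace 𝕜 E] {A : E →L[𝕜] E} {φ ψ : ι → E} (h : IsNuclearRep A φ ψ)
    (b : HilbertBasis w 𝕜 E) :
    ∑' i, inner 𝕜 (b i) (A (b i)) = ∑' l, inner 𝕜 (φ l) (ψ l) := by
  -- Expanding in the basis gives a double sum, absolutely convergent by Bessel's inequality.
  set F : ι × w → 𝕜 := fun p => inner 𝕜 (φ p.1) (b p.2) * inner 𝕜 (b p.2) (ψ p.1) with hF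
  have hsum1 : ∀ l, Summable fun i => ‖F (l, i)‖ := fun l =>
    summable_of_sum_le (fun _ => norm_nonneg _)
      (sum_norm_inner_mul_norm_inner_le b.orthonormal (φ l) (ψ l))
  have hsum : Summable F := by
    refine Summable.of_norm ((summable_prod_of_nonneg fun _ => norm_nonneg _).2 ⟨hsum1, ?_⟩)
    refine Summable.of_nonneg_of_le (fun l => tsum_nonneg fun _ => norm_nonneg _) (fun l => ?_)
      h.summable
    exact (hsum1 l).tsum_le_of_sum_le
      (sum_norm_inner_mul_norm_inner_le b.orthonormal (φ l) (ψ l))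
  have h1 : ∀ i, inner 𝕜 (b i) (A (b i)) = ∑' l, F (l, i) := by
    intro i
    have := (h.hasSum (b i)).mapL (innerSL 𝕜 (b i))
    rw [← innerSL_apply_apply 𝕜, ← this.tsum_eq]
    refine tsum_congr fun l => ?_
    simp [hF]
  have h2 : ∀ l, inner 𝕜 (φ l) (ψ l) = ∑' i, F (l, i) := fun l =>
    (b.tsum_inner_mul_inner (φ l) (ψ l)).symm
  simp only [h1, h2]
  exact Summable.tsum_comm (f := fun l i => F (l, i)) hsum

theorem IsNuclearRep.opTrace_eq {ι E : Type*} [NormedAddCommGroup E]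
    [InnerProductSpace 𝕜 E] [CompleteSpace E] {A : E →L[𝕜] E} {φ ψ : ι → E}
    (h : IsNuclearRep A φ ψ) : opTrace A = ∑' l, inner 𝕜 (φ l) (ψ l) :=
  h.tsum_inner_eq _

/-! ### Products over tuples -/

theorem summable_prod_tuple {ι : Type*} {t : ι → ℝ} (h0 : ∀ l, 0 ≤ t l) (ht : Summable t)
    (k : ℕ) : Summable (fun f : Fin k → ι => ∏ i, t (f i)) ∧
      ∑' f : Fin k → ι, ∏ i, t (f i) ≤ (∑' l, t l) ^ k := by
  classical
  have key : ∀ F : Finset (Fin k → ι), ∑ f ∈ F, ∏ i, t (f i) ≤ (∑' l, t l) ^ k := by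
    intro F
    set s : Finset ι := F.biUnion fun f => Finset.univ.image f with hs
    have hF : F ⊆ Fintype.piFinset fun _ => s := by
      intro f hf
      rw [Fintype.mem_piFinset]
      intro i
      exact Finset.mem_biUnion.2 ⟨f, hf, Finset.mem_image_of_mem _ (Finset.mem_univ i)⟩
    calc ∑ f ∈ F, ∏ i, t (f i) ≤ ∑ f ∈ Fintype.piFinset fun _ => s, ∏ i, t (f i) :=
          Finset.sum_le_sum_of_subset_of_nonneg hF fun f _ _ =>
            Finset.prod_nonneg fun i _ => h0 _
      _ = (∑ l ∈ s, t l) ^ k := by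
          rw [← Finset.prod_univ_sum (fun _ : Fin k => s) (fun _ l => t l)]; simp
      _ ≤ (∑' l, t l) ^ k := by
          gcongr
          · exact Finset.sum_nonneg fun l _ => h0 l
          · exact ht.sum_le_tsum _ fun l _ => h0 l
  have hsum : Summable (fun f : Fin k → ι => ∏ i, t (f i)) :=
    summable_of_sum_le (fun f => Finset.prod_nonneg fun i _ => h0 _) key
  exact ⟨hsum, hsum.tsum_le_of_sum_le key⟩

theorem tendsto_piFinset_atTop (ι : Type*) (k : ℕ) :
    Tendsto (fun s : Finset ι => Fintype.piFinset fun _ : Fin k => s) atTop atTop := by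
  classical
  refine tendsto_atTop_finset_of_monotone (fun s t hst => Fintype.piFinset_subset _ _ fun _ => hst)
    fun f => ⟨Finset.univ.image f, ?_⟩
  rw [Fintype.mem_piFinset]
  exact fun i => Finset.mem_image_of_mem _ (Finset.mem_univ i)

/-- The Cauchy–Binet formula for infinite sums, with the sum running over all tuples. -/
theorem hasSum_det_mul_det {ι : Type*} {k : ℕ} {a b : Fin k → ι → 𝕜}
    {M : Matrix (Fin k) (Fin k) 𝕜} (hM : ∀ i j, HasSum (fun l => a i l * b j l) (M i j))
    (hs : Summable fun f : Fin k → ι =>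
      (Matrix.of fun i j => a i (f j)).det * (Matrix.of fun i j => b i (f j)).det) :
    HasSum (fun f : Fin k → ι =>
      (Matrix.of fun i j => a i (f j)).det * (Matrix.of fun i j => b i (f j)).det)
      (k.factorial * M.det) := by
  classical
  set D : (Fin k → ι) → 𝕜 := fun f =>
    (Matrix.of fun i j => a i (f j)).det * (Matrix.of fun i j => b i (f j)).det with hD
  have h1 : Tendsto (fun s : Finset ι => (k.factorial : 𝕜) *
      (Matrix.of fun i j => ∑ l ∈ s, a i l * b j l).det) atTop (𝓝 (k.factorial * M.det)) := by
    refine Tendsto.const_mul _ ?_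
    have hc : Continuous fun N : Matrix (Fin k) (Fin k) 𝕜 => N.det := Continuous.matrix_det
      continuous_id
    refine (hc.tendsto M).comp ?_
    exact tendsto_pi_nhds.2 fun i => tendsto_pi_nhds.2 fun j => hM i j
  have h2 : ∀ s : Finset ι, (k.factorial : 𝕜) *
      (Matrix.of fun i j => ∑ l ∈ s, a i l * b j l).det =
      ∑ f ∈ Fintype.piFinset fun _ : Fin k => s, D f := by
    intro s
    have := factorial_mul_det (fun _ : s => (1 : 𝕜)) (fun i l => a i l) (fun (j : Fin k) l => b j l)
    simp only [mul_one, Finset.prod_const_one, one_mul] at this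
    have e : (Matrix.of fun i j => ∑ l ∈ s, a i l * b j l) =
        Matrix.of fun i j => ∑ l : s, a i l * b j l := by
      ext i j
      exact (Finset.sum_coe_sort s fun l => a i l * b j l).symm
    rw [e, this]
    refine Finset.sum_nbij (fun f i => (f i : ι)) ?_ ?_ ?_ ?_
    · intro f _; simp [Fintype.mem_piFinset]
    · intro f _ g _ hfg
      ext i
      exact congrFun hfg i
    · intro f hf
      simp only [Finset.mem_coe, Fintype.mem_piFinset] at hf
      exact ⟨fun i => ⟨f i, hf i⟩, by simp, rfl⟩
    · intro f _; rfl
  have h3 := hs.hasSum.comp (tendsto_piFinset_atTop ι k)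
  rw [funext h2] at h1
  rw [← tendsto_nhds_unique h3 h1]
  exact hs.hasSum

end Representation

section Wedge

variable {𝕜 : Type*} [RCLike 𝕜] {H : Type u} [NormedAddCommGroup H] [InnerProductSpace 𝕜 H]

/-! ### Hadamard's inequality for decomposable elements -/

open scoped ComplexOrder in
/-- Since `λ ≤ exp (λ - 1)`, a positive semidefinite matrix with trace `k` has determinant at
most `1`. -/
theorem re_det_gram_le_one {k : ℕ} {x : Fin k → H} (hx : ∀ i, ‖x i‖ = 1) :
    RCLike.re (Matrix.gram 𝕜 x).det ≤ 1 := by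
  have hP := Matrix.posSemidef_gram 𝕜 x
  have hA := hP.isHermitian
  have htr : ∑ i, hA.eigenvalues i = k := by
    have h := hA.trace_eq_sum_eigenvalues
    have h' : (Matrix.gram 𝕜 x).trace = ((k : ℝ) : 𝕜) := by
      simp [Matrix.trace, Matrix.gram_apply, inner_self_eq_norm_sq_to_K, hx]
    rw [h', ← RCLike.ofReal_sum] at h
    exact (RCLike.ofReal_injective h).symm
  rw [hA.det_eq_prod_eigenvalues, ← RCLike.ofReal_prod, RCLike.ofReal_re]
  calc ∏ i, hA.eigenvalues i ≤ ∏ i, Real.exp (hA.eigenvalues i - 1) :=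
        Finset.prod_le_prod (fun i _ => hP.eigenvalues_nonneg i) fun i _ => by
          have := Real.add_one_le_exp (hA.eigenvalues i - 1); linarith
    _ = 1 := by rw [← Real.exp_sum, Finset.sum_sub_distrib, htr]; simp

variable [CompleteSpace H]

/-- Hadamard's inequality. -/
theorem norm_wedge_le {k : ℕ} (x : Fin k → H) :
    ‖(wedge x : AlgExteriorPower 𝕜 H k)‖ ≤ ∏ i, ‖x i‖ := by
  by_cases h0 : ∃ i, x i = 0
  · obtain ⟨i, hi⟩ := h0
    have : (wedge x : AlgExteriorPower 𝕜 H k) = 0 :=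
      (exteriorPower.ιMulti 𝕜 k (M := H)).map_coord_zero i hi
    rw [this, norm_zero]
    positivity
  push Not at h0
  set u : Fin k → H := fun i => ((‖x i‖⁻¹ : ℝ) : 𝕜) • x i with hu
  have hxu : x = fun i => ((‖x i‖ : ℝ) : 𝕜) • u i := by
    ext i
    have : ((‖x i‖ : ℝ) : 𝕜) ≠ 0 := by simpa using h0 i
    simp [hu, smul_smul, mul_inv_cancel₀ this]
  have hu1 : ∀ i, ‖u i‖ = 1 := by
    intro i
    have : ‖x i‖ ≠ 0 := by simpa using h0 i
    simp [hu, norm_smul, inv_mul_cancel₀ this]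
  have hw : (wedge x : AlgExteriorPower 𝕜 H k) =
      (∏ i, ((‖x i‖ : ℝ) : 𝕜)) • (wedge u : AlgExteriorPower 𝕜 H k) := by
    conv_lhs => rw [hxu]
    exact (exteriorPower.ιMulti 𝕜 k (M := H)).toMultilinearMap.map_smul_univ _ u
  have h1 : ‖(wedge u : AlgExteriorPower 𝕜 H k)‖ ≤ 1 := by
    have h := norm_sq_eq_re_inner (𝕜 := 𝕜) (wedge u : AlgExteriorPower 𝕜 H k)
    rw [inner_wedge_wedge] at h
    have h2 := re_det_gram_le_one (𝕜 := 𝕜) hu1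
    have h3 : ‖(wedge u : AlgExteriorPower 𝕜 H k)‖ ^ 2 ≤ 1 := h.trans_le h2
    exact (sq_le_one_iff₀ (norm_nonneg _)).1 h3
  rw [hw, norm_smul, norm_prod]
  simpa using mul_le_mul_of_nonneg_left h1 (Finset.prod_nonneg fun i _ => norm_nonneg (x i))

theorem norm_det_inner_le {k : ℕ} (x y : Fin k → H) :
    ‖(Matrix.of fun i j => inner 𝕜 (x i) (y j)).det‖ ≤ (∏ i, ‖x i‖) * ∏ i, ‖y i‖ := by
  rw [← inner_wedge_wedge]
  exact (norm_inner_le_norm _ _).trans (mul_le_mul (norm_wedge_le x) (norm_wedge_le y)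
    (norm_nonneg _) (Finset.prod_nonneg fun i _ => norm_nonneg (x i)))

/-! ### Density of decomposable elements -/

theorem dense_span_wedge (k : ℕ) : Dense (Submodule.span 𝕜 (Set.range fun x : Fin k → H =>
    ((wedge x : AlgExteriorPower 𝕜 H k) : ExteriorPower 𝕜 H k)) : Set (ExteriorPower 𝕜 H k)) := by
  refine (UniformSpace.Completion.denseRange_coe (α := AlgExteriorPower 𝕜 H k)).mono ?_
  rintro _ ⟨ω, rfl⟩
  have key : ∀ ω : AlgExteriorPower 𝕜 H k, ω ∈ Submodule.span 𝕜
      (Set.range fun x : Fin k → H => (wedge x : AlgExteriorPower 𝕜 H k)) := by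
    intro ω
    have h := exteriorPower.ιMulti_span 𝕜 k (M := H)
    exact h.symm ▸ (Submodule.mem_top (x := (ω : ⋀[𝕜]^k H)))
  have h := Submodule.mem_map_of_mem
    (f := (UniformSpace.Completion.toComplL (𝕜 := 𝕜) (E := AlgExteriorPower 𝕜 H k)).toLinearMap)
    (key ω)
  rw [Submodule.map_span, ← Set.range_comp] at h
  exact h

theorem exteriorPower_clm_ext {k : ℕ} {S T : ExteriorPower 𝕜 H k →L[𝕜] ExteriorPower 𝕜 H k}
    (h : ∀ x y : Fin k → H,
      inner 𝕜 ((wedge y : AlgExteriorPower 𝕜 H k) : ExteriorPower 𝕜 H k)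
        (S ((wedge x : AlgExteriorPower 𝕜 H k) : ExteriorPower 𝕜 H k)) =
      inner 𝕜 ((wedge y : AlgExteriorPower 𝕜 H k) : ExteriorPower 𝕜 H k)
        (T ((wedge x : AlgExteriorPower 𝕜 H k) : ExteriorPower 𝕜 H k))) : S = T := by
  refine ContinuousLinearMap.ext_on (dense_span_wedge k) ?_
  rintro _ ⟨x, rfl⟩
  refine (dense_span_wedge (𝕜 := 𝕜) (H := H) k).eq_of_inner_right (𝕜 := 𝕜) fun v hv => ?_
  induction hv using Submodule.span_induction with
  | mem v hv => obtain ⟨y, rfl⟩ := hv; exact h x y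
  | zero => simp
  | add v w _ _ hv hw => simp only [inner_add_left, hv, hw]
  | smul c v _ hv => simp only [inner_smul_left, hv]

end Wedge

section ExteriorTrace

variable {𝕜 : Type*} [RCLike 𝕜] {H : Type u} [NormedAddCommGroup H] [InnerProductSpace 𝕜 H]

/-! ### The traces of the exterior powers of a nuclear operator -/

theorem exists_isNuclearRep {ι E : Type*} [NormedAddCommGroup E] [InnerProductSpace 𝕜 E]
    [CompleteSpace E] {φ ψ : ι → E} (h : Summable fun l => ‖φ l‖ * ‖ψ l‖) :
    ∃ S : E →L[𝕜] E, IsNuclearRep S φ ψ := by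
  have hs : Summable fun l => (innerSL 𝕜 (φ l)).smulRight (ψ l) := by
    refine Summable.of_norm ?_
    simpa [ContinuousLinearMap.norm_smulRight_apply] using h
  refine ⟨∑' l, (innerSL 𝕜 (φ l)).smulRight (ψ l), h, fun x => ?_⟩
  have := hs.hasSum.mapL (ContinuousLinearMap.apply 𝕜 E x)
  simpa using this

variable [CompleteSpace H]

theorem IsNuclearRep.summable_det {ι : Type*} {A : H →L[𝕜] H} {φ ψ : ι → H}
    (h : IsNuclearRep A φ ψ) (k : ℕ) :
    Summable fun f : Fin k → ι => (Matrix.of fun i j => inner 𝕜 (φ (f i)) (ψ (f j))).det := by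
  refine Summable.of_norm_bounded
    (summable_prod_tuple (fun l => by positivity) h.summable k).1 fun f => ?_
  rw [Finset.prod_mul_distrib]
  exact norm_det_inner_le (fun i => φ (f i)) fun i => ψ (f i)

/-- By the Cauchy–Binet formula, a nuclear representation of `A` induces one of `Λ^k(A)`, indexed
by tuples; the factor `1 / k!` compensates for the repetition of each `k`-element set. -/
theorem IsNuclearRep.exteriorMap {ι : Type*} {A : H →L[𝕜] H} {φ ψ : ι → H}
    (h : IsNuclearRep A φ ψ) (k : ℕ) :
    IsNuclearRep (exteriorMap k A)
      (fun f : Fin k → ι => (((k.factorial : 𝕜)⁻¹ •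
        wedge fun i => φ (f i) : AlgExteriorPower 𝕜 H k) : ExteriorPower 𝕜 H k))
      (fun f : Fin k → ι =>
        ((wedge fun i => ψ (f i) : AlgExteriorPower 𝕜 H k) : ExteriorPower 𝕜 H k)) := by
  have hp := (summable_prod_tuple (fun l => by positivity) h.summable k).1
  obtain ⟨S, hS⟩ := exists_isNuclearRep (𝕜 := 𝕜) (φ := fun f : Fin k → ι =>
      (((k.factorial : 𝕜)⁻¹ •
        wedge fun i => φ (f i) : AlgExteriorPower 𝕜 H k) : ExteriorPower 𝕜 H k))
      (ψ := fun f : Fin k → ι =>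
        ((wedge fun i => ψ (f i) : AlgExteriorPower 𝕜 H k) : ExteriorPower 𝕜 H k)) (by
    refine Summable.of_nonneg_of_le (fun f => by positivity) (fun f => ?_)
      (hp.mul_left ‖(k.factorial : 𝕜)⁻¹‖)
    rw [UniformSpace.Completion.norm_coe, UniformSpace.Completion.norm_coe, norm_smul,
      Finset.prod_mul_distrib, mul_assoc]
    gcongr
    · exact norm_wedge_le fun i => φ (f i)
    · exact norm_wedge_le fun i => ψ (f i))
  -- Both operators are tested against decomposable elements, where Cauchy–Binet applies.
  convert hS using 1
  refine exteriorPower_clm_ext fun x y => ?_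
  rw [exteriorMap_wedge, UniformSpace.Completion.inner_coe, inner_wedge_wedge]
  have h1 := (hS.hasSum ((wedge x : AlgExteriorPower 𝕜 H k) : ExteriorPower 𝕜 H k)).mapL
    (innerSL 𝕜 ((wedge y : AlgExteriorPower 𝕜 H k) : ExteriorPower 𝕜 H k))
  simp only [map_smul, innerSL_apply_apply, UniformSpace.Completion.inner_coe, inner_smul_left,
    inner_wedge_wedge, smul_eq_mul] at h1
  have hM : ∀ i j, HasSum (fun l => inner 𝕜 (y i) (ψ l) * inner 𝕜 (φ l) (x j))
      ((Matrix.of fun i j => inner 𝕜 (y i) (A (x j))) i j) := by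
    intro i j
    have := (h.hasSum (x j)).mapL (innerSL 𝕜 (y i))
    simpa [mul_comm] using this
  have hfac : (k.factorial : 𝕜) ≠ 0 := by exact_mod_cast k.factorial_ne_zero
  have e : ∀ f : Fin k → ι, conj (k.factorial : 𝕜)⁻¹ *
      (Matrix.of fun i j => inner 𝕜 (φ (f i)) (x j)).det *
      (Matrix.of fun i j => inner 𝕜 (y i) (ψ (f j))).det =
      (k.factorial : 𝕜)⁻¹ * ((Matrix.of fun i j => inner 𝕜 (y i) (ψ (f j))).det *
        (Matrix.of fun i j => inner 𝕜 (φ (f j)) (x i)).det) := by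
    intro f
    rw [← Matrix.det_transpose (Matrix.of fun i j => inner 𝕜 (φ (f i)) (x j))]
    have : conj (k.factorial : 𝕜)⁻¹ = (k.factorial : 𝕜)⁻¹ := by simp
    rw [this, mul_assoc, mul_comm (Matrix.det _)]
    rfl
  simp only [e] at h1
  have h2 := hasSum_det_mul_det hM ((summable_mul_left_iff (inv_ne_zero hfac)).1 h1.summable)
  have h3 := h2.mul_left (k.factorial : 𝕜)⁻¹
  rw [inv_mul_cancel_left₀ hfac] at h3
  exact h3.unique h1

/-- Fredholm's formula for the coefficients of the determinant `det (1 + z A)`. -/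
theorem IsNuclearRep.opTrace_exteriorMap {ι : Type*} {A : H →L[𝕜] H} {φ ψ : ι → H}
    (h : IsNuclearRep A φ ψ) (k : ℕ) :
    opTrace (HilbertExt.exteriorMap k A) = (k.factorial : 𝕜)⁻¹ *
      ∑' f : Fin k → ι, (Matrix.of fun i j => inner 𝕜 (φ (f i)) (ψ (f j))).det := by
  rw [(h.exteriorMap k).opTrace_eq, ← tsum_mul_left]
  refine tsum_congr fun f => ?_
  rw [UniformSpace.Completion.inner_coe, inner_smul_left, inner_wedge_wedge]
  simp

theorem IsNuclearRep.norm_opTrace_exteriorMap_le {ι : Type*} {A : H →L[𝕜] H} {φ ψ : ι → H}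
    (h : IsNuclearRep A φ ψ) (k : ℕ) :
    ‖opTrace (HilbertExt.exteriorMap k A)‖ ≤ (∑' l, ‖φ l‖ * ‖ψ l‖) ^ k / k.factorial := by
  have hp := summable_prod_tuple (fun l => by positivity) h.summable k
  rw [h.opTrace_exteriorMap, norm_mul, norm_inv, RCLike.norm_natCast, div_eq_inv_mul]
  gcongr
  refine le_trans (tsum_of_norm_bounded hp.1.hasSum fun f => ?_) hp.2
  rw [Finset.prod_mul_distrib]
  exact norm_det_inner_le (fun i => φ (f i)) fun i => ψ (f i)

theorem IsNuclearRep.opTrace_exteriorMap_zero {ι : Type*} {A : H →L[𝕜] H} {φ ψ : ι → H}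
    (h : IsNuclearRep A φ ψ) : opTrace (HilbertExt.exteriorMap 0 A) = 1 := by
  rw [h.opTrace_exteriorMap]
  simp

end ExteriorTrace

section TraceClass

variable {𝕜 : Type*} [RCLike 𝕜] {H : Type u} [NormedAddCommGroup H] [InnerProductSpace 𝕜 H]

/-! ### Trace class operators are nuclear -/

/-- `A` is nuclear: it is an absolutely convergent sum of operators of rank at most one. -/
def IsNuclear (A : H →L[𝕜] H) : Prop :=
  ∃ (ι : Type u) (φ ψ : ι → H), IsNuclearRep A φ ψ

/-- The space `H` with the semi-inner product `⟪P x, y⟫` of a positive operator `P`. -/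
def FormSpace {P : H →L[𝕜] H} (_ : P.IsPositive) : Type _ := H

variable {P : H →L[𝕜] H} (hP : P.IsPositive)

instance : AddCommGroup (FormSpace hP) := inferInstanceAs (AddCommGroup H)

instance : Module 𝕜 (FormSpace hP) := inferInstanceAs (Module 𝕜 H)

/-- The semi-inner product `⟪P x, y⟫`. -/
@[reducible] def formCore : PreInnerProductSpace.Core 𝕜 (FormSpace hP) where
  inner x y := inner 𝕜 (P x : H) (y : H)
  conj_inner_symm x y := by
    exact (inner_conj_symm (E := H) x (P y)).trans (hP.isSymmetric x y).symm
  re_inner_nonneg x := hP.re_inner_nonneg_left x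
  add_left x y z := by
    exact (congrArg (fun v : H => inner 𝕜 v (show H from z))
      (map_add P (show H from x) (show H from y))).trans
      (inner_add_left _ _ _)
  smul_left x y r := by
    exact (congrArg (fun v : H => inner 𝕜 v (show H from y)) (map_smul P r (show H from x))).trans
      (inner_smul_left _ _ _)

instance : SeminormedAddCommGroup (FormSpace hP) :=
  @InnerProductSpace.Core.toSeminormedAddCommGroup 𝕜 _ _ _ _ (formCore hP)

instance : InnerProductSpace 𝕜 (FormSpace hP) := InnerProductSpace.ofCore (formCore hP)

/-- The canonical map of `H` to the completion of `FormSpace hP`; it plays the part of the square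
root of `P`. -/
def formMap : H →L[𝕜] UniformSpace.Completion (FormSpace hP) :=
  (UniformSpace.Completion.toComplL (𝕜 := 𝕜) (E := FormSpace hP)).comp
    (LinearMap.mkContinuous
      ({ toFun := fun x => x, map_add' := fun _ _ => rfl, map_smul' := fun _ _ => rfl } :
        H →ₗ[𝕜] FormSpace hP) (‖P‖ + 1) (by
      intro x
      have h : @norm (FormSpace hP) _ x ^ 2 = RCLike.re (inner 𝕜 (P x) x) :=
        norm_sq_eq_re_inner (𝕜 := 𝕜) (E := FormSpace hP) x
      have h1 : RCLike.re (inner 𝕜 (P x) x) ≤ ‖P‖ * ‖x‖ * ‖x‖ :=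
        (RCLike.re_le_norm _).trans ((norm_inner_le_norm _ _).trans
          (by gcongr; exact P.le_opNorm x))
      have h2 : @norm (FormSpace hP) _ x ^ 2 ≤ ((‖P‖ + 1) * ‖x‖) ^ 2 := by
        rw [h]
        refine h1.trans ?_
        have := norm_nonneg P
        nlinarith [mul_nonneg (norm_nonneg x) (norm_nonneg x), mul_nonneg this this,
          mul_nonneg (mul_nonneg this this) (mul_nonneg (norm_nonneg x) (norm_nonneg x)),
          mul_nonneg this (mul_nonneg (norm_nonneg x) (norm_nonneg x))]
      exact abs_le_of_sq_le_sq' h2 (by positivity) |>.2))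

theorem inner_formMap (x y : H) : inner 𝕜 (formMap hP x) (formMap hP y) = inner 𝕜 (P x) y :=
  UniformSpace.Completion.inner_coe (𝕜 := 𝕜) (E := FormSpace hP) x y

theorem denseRange_formMap : DenseRange (formMap hP) :=
  UniformSpace.Completion.denseRange_coe (α := FormSpace hP)

variable [CompleteSpace H]

theorem adjoint_formMap_formMap (x : H) :
    ContinuousLinearMap.adjoint (formMap hP) (formMap hP x) = P x := by
  refine ext_inner_right 𝕜 fun y => ?_
  rw [ContinuousLinearMap.adjoint_inner_left, inner_formMap]

omit [CompleteSpace H] in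
/-- Parseval's identity. -/
theorem hasSum_norm_inner_sq {κ : Type*} (c : HilbertBasis κ 𝕜 H) (y : H) :
    HasSum (fun i => ‖inner 𝕜 (c i) y‖ ^ 2) (‖y‖ ^ 2) := by
  have h1 := (c.hasSum_inner_mul_inner y y).mapL RCLike.reCLM
  have h2 : RCLike.reCLM (inner 𝕜 y y) = ‖y‖ ^ 2 := (norm_sq_eq_re_inner (𝕜 := 𝕜) y).symm
  rw [h2] at h1
  refine h1.congr_fun fun i => ?_
  rw [← inner_conj_symm y (c i), RCLike.conj_mul, ← RCLike.ofReal_pow]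
  exact (RCLike.ofReal_re _).symm

/-- The Hilbert–Schmidt norm of an operator equals that of its adjoint. -/
theorem summable_norm_adjoint_sq {E F : Type*} [NormedAddCommGroup E] [InnerProductSpace 𝕜 E]
    [CompleteSpace E] [NormedAddCommGroup F] [InnerProductSpace 𝕜 F] [CompleteSpace F]
    {ι κ : Type*} (b : HilbertBasis ι 𝕜 E) (d : HilbertBasis κ 𝕜 F) (J : E →L[𝕜] F)
    (h : Summable fun i => ‖J (b i)‖ ^ 2) :
    Summable fun l => ‖ContinuousLinearMap.adjoint J (d l)‖ ^ 2 := by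
  have hs : Summable fun p : ι × κ => ‖inner 𝕜 (d p.2) (J (b p.1))‖ ^ 2 := by
    refine (summable_prod_of_nonneg fun _ => by positivity).2
      ⟨fun i => (hasSum_norm_inner_sq d (J (b i))).summable, ?_⟩
    simpa only [(hasSum_norm_inner_sq d _).tsum_eq] using h
  have hs' := (hs.comp_injective (Prod.swap_injective (α := κ) (β := ι))).prod
  refine hs'.congr fun l => ?_
  rw [← (hasSum_norm_inner_sq b (ContinuousLinearMap.adjoint J (d l))).tsum_eq]
  refine tsum_congr fun i => ?_
  simp only [Function.comp, Prod.swap]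
  rw [ContinuousLinearMap.adjoint_inner_right, norm_inner_symm]

/-- With `J` the square root of `P = |A|` provided by `formMap`, the identity `‖A x‖ = ‖P x‖` lets
one factor `A = B J` with `‖B k‖ ≤ ‖J* k‖`; both `J*` and `B` are then Hilbert–Schmidt, and
expanding `J x` in a Hilbert basis represents `A`. -/
theorem IsTraceClass.isNuclear {A : H →L[𝕜] H} (hA : IsTraceClass A) : IsNuclear A := by
  obtain ⟨P, hP, hPA, w, b, hb⟩ := hA
  set J := formMap hP with hJ
  have hnorm : ∀ x, ‖A x‖ = ‖P x‖ := by
    intro x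
    have h1 : inner 𝕜 (P x) (P x) = inner 𝕜 (A x) (A x) := by
      have h2 : P (P x) = ContinuousLinearMap.adjoint A (A x) := congrArg (fun T => T x) hPA
      rw [← ContinuousLinearMap.adjoint_inner_left A, ← h2]
      exact (hP.isSymmetric (P x) x).symm
    rw [@norm_eq_sqrt_re_inner 𝕜, @norm_eq_sqrt_re_inner 𝕜, h1]
  have hle : ∀ x, ‖A x‖ ≤ ‖ContinuousLinearMap.adjoint J‖ * ‖J x‖ := by
    intro x
    rw [hnorm, ← adjoint_formMap_formMap hP]
    exact ContinuousLinearMap.le_opNorm _ _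
  set B := (A : H →ₗ[𝕜] H).extendOfNorm
    (J : H →ₗ[𝕜] UniformSpace.Completion (FormSpace hP)) with hB
  have hBJ : ∀ x, B (J x) = A x := fun x =>
    LinearMap.extendOfNorm_eq (denseRange_formMap hP) ⟨_, hle⟩ x
  have hBnorm : ∀ k, ‖B k‖ ≤ ‖ContinuousLinearMap.adjoint J k‖ := by
    intro k
    refine (denseRange_formMap hP).induction_on k (isClosed_le (by fun_prop) (by fun_prop)) ?_
    intro x
    rw [← hJ, hBJ, hnorm, ← adjoint_formMap_formMap hP]
  obtain ⟨v, d, -⟩ := exists_hilbertBasis 𝕜 (UniformSpace.Completion (FormSpace hP))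
  have hJb : Summable fun i => ‖J (b i)‖ ^ 2 := by
    refine hb.congr fun i => ?_
    rw [norm_sq_eq_re_inner (𝕜 := 𝕜), inner_formMap]
  have hs := summable_norm_adjoint_sq b d J hJb
  refine ⟨v, fun l => ContinuousLinearMap.adjoint J (d l), fun l => B (d l), ?_, fun x => ?_⟩
  · refine Summable.of_nonneg_of_le (fun l => by positivity) (fun l => ?_) hs
    rw [sq]
    gcongr
    exact hBnorm _
  · have h := (d.hasSum_repr (J x)).mapL B
    rw [hBJ] at h
    refine h.congr_fun fun l => ?_
    rw [map_smul, d.repr_apply_apply, ContinuousLinearMap.adjoint_inner_left]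

end TraceClass

section Eigenvector

variable {𝕜 : Type*} [RCLike 𝕜] {H : Type u} [NormedAddCommGroup H] [InnerProductSpace 𝕜 H]

/-! ### Splitting off an eigenvector -/

/-- Expansion of the sum of all principal minors along an index whose column vanishes off the
diagonal. -/
theorem tsum_det_option {ι : Type*} {G : Option ι → Option ι → 𝕜}
    (h0 : ∀ n, G (some n) none = 0) (k : ℕ)
    (hs : Summable fun f : Fin (k + 1) → Option ι =>
      (Matrix.of fun i j => G (f i) (f j)).det) :
    ∑' f : Fin (k + 1) → Option ι, (Matrix.of fun i j => G (f i) (f j)).det =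
      ∑' f : Fin (k + 1) → ι, (Matrix.of fun i j => G (some (f i)) (some (f j))).det +
      (k + 1) * (G none none *
        ∑' f : Fin k → ι, (Matrix.of fun i j => G (some (f i)) (some (f j))).det) := by
  classical
  set D : (Fin (k + 1) → Option ι) → 𝕜 := fun f => (Matrix.of fun i j => G (f i) (f j)).det with hD
  set g0 : (Fin (k + 1) → ι) → Fin (k + 1) → Option ι := fun f i => some (f i) with hg0
  set g : Fin (k + 1) → (Fin k → ι) → Fin (k + 1) → Option ι :=
    fun p f => p.insertNth (α := fun _ => Option ι) none fun i => some (f i) with hg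
  have hg0i : Function.Injective g0 := by
    intro f f' hff
    ext i
    exact Option.some_injective _ (congrFun hff i)
  have hgi : ∀ p, Function.Injective (g p) := by
    intro p f f' hff
    ext i
    have := congrFun hff (p.succAbove i)
    simpa [hg] using this
  have hmem0 : ∀ f, f ∈ Set.range g0 ↔ ∀ i, f i ≠ none := by
    intro f
    constructor
    · rintro ⟨f, rfl⟩ i; simp [hg0]
    · intro hf
      choose f' hf' using fun i => Option.ne_none_iff_exists.1 (hf i)
      exact ⟨f', funext hf'⟩
  have hmem : ∀ p f, f ∈ Set.range (g p) ↔ f p = none ∧ ∀ i, i ≠ p → f i ≠ none := by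
    intro p f
    constructor
    · rintro ⟨f, rfl⟩
      refine ⟨by simp [hg], fun i hi => ?_⟩
      obtain ⟨j, rfl⟩ := Fin.exists_succAbove_eq hi
      simp [hg]
    · rintro ⟨hp, hf⟩
      choose f' hf' using fun i => Option.ne_none_iff_exists.1 (hf _ (Fin.succAbove_ne p i))
      refine ⟨f', ?_⟩
      rw [hg]
      refine (Fin.insertNth_eq_iff).2 ⟨hp.symm, ?_⟩
      ext1 i
      exact hf' i
  -- A tuple hits `none` at no place, at exactly one place, or has a vanishing minor.
  have hdecomp : ∀ f, D f = (Set.range g0).indicator D f +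
      ∑ p, (Set.range (g p)).indicator D f := by
    intro f
    by_cases hf : ∀ i, f i ≠ none
    · rw [Set.indicator_of_mem ((hmem0 f).2 hf), Finset.sum_eq_zero, add_zero]
      intro p _
      exact Set.indicator_of_notMem (fun h => hf p ((hmem p f).1 h).1) _
    · rw [Set.indicator_of_notMem (fun h => hf ((hmem0 f).1 h)), zero_add]
      push Not at hf
      obtain ⟨p, hp⟩ := hf
      by_cases hq : ∀ i, i ≠ p → f i ≠ none
      · rw [Finset.sum_eq_single p, Set.indicator_of_mem ((hmem p f).2 ⟨hp, hq⟩)]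
        · intro q _ hqp
          exact Set.indicator_of_notMem (fun h => hq q hqp ((hmem q f).1 h).1) _
        · simp
      · push Not at hq
        obtain ⟨q, hqp, hq⟩ := hq
        have hDf : D f = 0 := by
          refine Matrix.det_zero_of_row_eq hqp ?_
          ext j
          simp [hp, hq]
        rw [hDf, Finset.sum_eq_zero]
        intro r _
        by_cases h : f ∈ Set.range (g r)
        · rw [Set.indicator_of_mem h, hDf]
        · exact Set.indicator_of_notMem h _
  have ht : ∀ {X : Type _} (u : X → Fin (k + 1) → Option ι), Function.Injective u →
      ∑' f, (Set.range u).indicator D f = ∑' x, D (u x) := by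
    intro X u hu
    rw [← hu.tsum_eq (f := (Set.range u).indicator D) Set.support_indicator_subset]
    exact tsum_congr fun x => Set.indicator_of_mem (Set.mem_range_self x) _
  have hminor : ∀ p f, D (g p f) =
      G none none * (Matrix.of fun i j => G (some (f i)) (some (f j))).det := by
    intro p f
    rw [hD]
    simp only
    rw [Matrix.det_succ_column _ p, Finset.sum_eq_single p]
    · have : ((-1 : 𝕜)) ^ ((p : ℕ) + p) = 1 := Even.neg_one_pow ⟨p, rfl⟩
      rw [this, one_mul]
      congr 1
      · simp [hg]
      · congr 1
        ext i j
        simp [hg]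
    · intro i _ hi
      obtain ⟨j, rfl⟩ := Fin.exists_succAbove_eq hi
      simp [hg, h0]
    · simp
  rw [tsum_congr hdecomp, Summable.tsum_add (hs.indicator _) (summable_sum fun p _ =>
    hs.indicator _), Summable.tsum_finsetSum fun p _ => hs.indicator _, ht g0 hg0i,
    Finset.sum_congr rfl fun p _ => (ht (g p) (hgi p)).trans (tsum_congr (hminor p))]
  simp [tsum_mul_left]
  rfl

/-- The operator `x ↦ x - ⟪v, x⟫ v`; for a unit vector `v` it is the orthogonal projection onto
the complement of `v`. -/
def deflate (v : H) : H →L[𝕜] H := ContinuousLinearMap.id 𝕜 H - (innerSL 𝕜 v).smulRight v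

theorem deflate_apply (v x : H) : deflate (𝕜 := 𝕜) v x = x - inner 𝕜 v x • v := by
  simp [deflate]

theorem inner_deflate_left (v x y : H) :
    inner 𝕜 (deflate (𝕜 := 𝕜) v x) y = inner 𝕜 x (deflate (𝕜 := 𝕜) v y) := by
  simp only [deflate_apply, inner_sub_left, inner_sub_right, inner_smul_left, inner_smul_right,
    inner_conj_symm]
  ring

theorem inner_deflate_right_eq_zero {v : H} (hv : ‖v‖ = 1) (x : H) :
    inner 𝕜 v (deflate (𝕜 := 𝕜) v x) = 0 := by
  rw [deflate_apply, inner_sub_right, inner_smul_right, inner_self_eq_norm_sq_to_K, hv]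
  simp

theorem deflate_deflate {v : H} (hv : ‖v‖ = 1) (x : H) :
    deflate (𝕜 := 𝕜) v (deflate (𝕜 := 𝕜) v x) = deflate (𝕜 := 𝕜) v x := by
  rw [deflate_apply (𝕜 := 𝕜) v (deflate (𝕜 := 𝕜) v x), inner_deflate_right_eq_zero hv, zero_smul,
    sub_zero]

theorem hasSum_option {ι E : Type*} [NormedAddCommGroup E] {f : Option ι → E} {a : E}
    (h : HasSum (fun n => f (some n)) a) : HasSum f (f none + a) := by
  classical
  have h1 : HasSum (fun o => if o = none then 0 else f o) a := by
    refine ((Option.some_injective ι).hasSum_iff fun o ho => ?_).1 (by simpa [Function.comp_def])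
    cases o with
    | none => simp
    | some n => exact absurd ⟨n, rfl⟩ ho
  refine ((hasSum_ite_eq none (f none)).add h1).congr_fun fun o => ?_
  by_cases ho : o = none <;> simp [ho]

variable [CompleteSpace H]

/-- Let `v` be a unit eigenvector of `B`. In the representation of `B` that starts with `⟪v, ·⟫ μ v`
and has all other functionals orthogonal to `v`, the column of the index of `v` vanishes off the
diagonal. Hence `det (1 + z B) = (1 + μ z) det (1 + z B')` for the compression `B'` of `B` to the
complement of `v`. -/
theorem IsNuclear.split_eigenvector {B : H →L[𝕜] H} (hB : IsNuclear B) {v : H} (hv : ‖v‖ = 1)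
    {μ : 𝕜} (hBv : B v = μ • v) :
    IsNuclear (deflate v ∘L B ∘L deflate v) ∧ ∀ k, opTrace (exteriorMap (k + 1) B) =
      opTrace (exteriorMap (k + 1) (deflate v ∘L B ∘L deflate v)) +
      μ * opTrace (exteriorMap k (deflate v ∘L B ∘L deflate v)) := by
  obtain ⟨ι, φ, ψ, h⟩ := hB
  set D : H →L[𝕜] H := deflate v with hD
  have hsum : Summable fun l => ‖D (φ l)‖ * ‖ψ l‖ := by
    refine Summable.of_nonneg_of_le (fun l => by positivity) (fun l => ?_)
      (h.summable.mul_left ‖D‖)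
    rw [← mul_assoc]
    gcongr
    exact D.le_opNorm _
  have h' : IsNuclearRep (D ∘L B ∘L D) (fun l => D (φ l)) (fun l => D (ψ l)) := by
    refine ⟨?_, fun x => ?_⟩
    · refine Summable.of_nonneg_of_le (fun l => by positivity) (fun l => ?_) (hsum.mul_left ‖D‖)
      rw [mul_left_comm]
      gcongr
      exact D.le_opNorm _
    · have := (h.hasSum (D x)).mapL D
      simpa [inner_deflate_left, hD] using this
  have hopt : IsNuclearRep B (fun l : Option ι => l.elim v fun n => D (φ n))
      (fun l : Option ι => l.elim (μ • v) ψ) := by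
    refine ⟨(hasSum_option hsum.hasSum).summable, fun x => ?_⟩
    have hx : B x = inner 𝕜 v x • μ • v + B (D x) := by
      rw [hD, deflate_apply, map_sub, map_smul, hBv]; abel
    have h2 : HasSum (fun n => inner 𝕜 (D (φ n)) x • ψ n) (B (D x)) := by
      simpa [inner_deflate_left, hD] using h.hasSum (D x)
    rw [hx]
    exact hasSum_option (f := fun l : Option ι => inner 𝕜 (l.elim v fun n => D (φ n)) x •
      l.elim (μ • v) ψ) h2
  refine ⟨⟨ι, _, _, h'⟩, fun k => ?_⟩
  rw [hopt.opTrace_exteriorMap, tsum_det_option (G := fun a b =>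
    inner 𝕜 (a.elim v fun n => D (φ n)) (b.elim (μ • v) ψ)) ?_ k (hopt.summable_det (k + 1)),
    h'.opTrace_exteriorMap, h'.opTrace_exteriorMap]
  · have e : ∀ m n, inner 𝕜 (D (φ m)) (D (ψ n)) = inner 𝕜 (D (φ m)) (ψ n) := by
      intro m n
      rw [hD, ← inner_deflate_left, deflate_deflate hv]
    have hμ : inner 𝕜 v (μ • v) = μ := by
      rw [inner_smul_right, inner_self_eq_norm_sq_to_K, hv]; simp
    have hk : ((k + 1 : ℕ) : 𝕜) ≠ 0 := by exact_mod_cast k.succ_ne_zero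
    have hk' : (k.factorial : 𝕜) ≠ 0 := by exact_mod_cast k.factorial_ne_zero
    simp only [Option.elim, e, hμ]
    rw [Nat.factorial_succ]
    push_cast at hk ⊢
    field_simp
  · intro n
    simp only [Option.elim]
    rw [hD, inner_deflate_left, deflate_apply, inner_smul_right, inner_self_eq_norm_sq_to_K, hv]
    simp

end Eigenvector

section Determinant

variable {𝕜 : Type*} [RCLike 𝕜] {H : Type u} [NormedAddCommGroup H] [InnerProductSpace 𝕜 H]

/-! ### Triangular flags -/

/-- `EigenFlag A [μ_n, …, μ_1] W`: the subspace `W` has a basis `v_1, …, v_n` in which `A` is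
triangular with diagonal `μ_1, …, μ_n`. -/
inductive EigenFlag (A : H →L[𝕜] H) : List 𝕜 → Submodule 𝕜 H → Prop
  | nil : EigenFlag A [] ⊥
  | cons {L : List 𝕜} {W : Submodule 𝕜 H} (μ : 𝕜) (v : H) (hW : EigenFlag A L W) (hv : v ∉ W)
      (hAv : A v - μ • v ∈ W) : EigenFlag A (μ :: L) (W ⊔ Submodule.span 𝕜 {v})

theorem EigenFlag.map_mem {A : H →L[𝕜] H} {L : List 𝕜} {W : Submodule 𝕜 H}
    (h : EigenFlag A L W) {w : H} (hw : w ∈ W) : A w ∈ W := by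
  induction h generalizing w with
  | nil => simp_all
  | cons μ v hW hv hAv ih =>
    obtain ⟨x, hx, y, hy, rfl⟩ := Submodule.mem_sup.1 hw
    obtain ⟨c, rfl⟩ := Submodule.mem_span_singleton.1 hy
    refine Submodule.mem_sup.2 ⟨A x + c • (A v - μ • v),
      add_mem (ih hx) (Submodule.smul_mem _ _ hAv), (c * μ) • v,
      Submodule.smul_mem _ _ (Submodule.mem_span_singleton_self v), ?_⟩
    rw [map_add, map_smul, smul_sub, smul_smul]
    abel

theorem EigenFlag.finiteDimensional {A : H →L[𝕜] H} {L : List 𝕜} {W : Submodule 𝕜 H}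
    (h : EigenFlag A L W) : FiniteDimensional 𝕜 W := by
  induction h with
  | nil => infer_instance
  | cons μ v hW hv hAv ih => infer_instance

theorem EigenFlag.finrank_eq {A : H →L[𝕜] H} {L : List 𝕜} {W : Submodule 𝕜 H}
    (h : EigenFlag A L W) : Module.finrank 𝕜 W = L.length := by
  induction h with
  | nil => simp
  | @cons L W μ v hW hv hAv ih =>
    have := hW.finiteDimensional
    have h0 : v ≠ 0 := fun h0 => hv (h0 ▸ W.zero_mem)
    have hd : Disjoint W (Submodule.span 𝕜 {v}) := by
      rw [Submodule.disjoint_span_singleton' h0]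
      exact hv
    have h1 := Submodule.finrank_sup_add_finrank_inf_eq W (Submodule.span 𝕜 {v})
    rw [hd.eq_bot, finrank_bot, finrank_span_singleton h0, ih] at h1
    simpa using h1

/-! ### The Fredholm determinant as an entire function -/

/-- The inclusion of `𝕜`, which is `ℝ` or `ℂ`, in `ℂ`. -/
def toComplex : 𝕜 →+* ℂ where
  toFun x := ⟨RCLike.re x, RCLike.im x⟩
  map_one' := by apply Complex.ext <;> simp
  map_mul' x y := by apply Complex.ext <;> simp
  map_zero' := by apply Complex.ext <;> simp
  map_add' x y := by apply Complex.ext <;> simp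

theorem norm_toComplex (x : 𝕜) : ‖toComplex x‖ = ‖x‖ := by
  rw [← sq_eq_sq₀ (norm_nonneg _) (norm_nonneg _), ← Complex.normSq_eq_norm_sq,
    ← RCLike.normSq_eq_def']
  simp [toComplex, Complex.normSq_apply, RCLike.normSq_apply]

variable [CompleteSpace H]

/-- The Fredholm determinant `det (1 + z A) = ∑ tr Λ^k(A) z^k`, as a function of a complex
variable `z` even when the scalars are real. -/
def fredholmDet (A : H →L[𝕜] H) (z : ℂ) : ℂ :=
  ∑' k : ℕ, toComplex (opTrace (exteriorMap k A)) * z ^ k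

theorem IsNuclear.exists_norm_le {A : H →L[𝕜] H} (hA : IsNuclear A) :
    ∃ T : ℝ, 0 ≤ T ∧ ∀ k, ‖opTrace (exteriorMap k A)‖ ≤ T ^ k / k.factorial := by
  obtain ⟨ι, φ, ψ, h⟩ := hA
  exact ⟨_, tsum_nonneg fun l => by positivity, h.norm_opTrace_exteriorMap_le⟩

theorem IsNuclear.opTrace_exteriorMap_zero {A : H →L[𝕜] H} (hA : IsNuclear A) :
    opTrace (exteriorMap 0 A) = 1 := by
  obtain ⟨ι, φ, ψ, h⟩ := hA
  exact h.opTrace_exteriorMap_zero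

theorem IsNuclear.exists_summable_bound {A : H →L[𝕜] H} (hA : IsNuclear A) (R : ℝ) :
    ∃ u : ℕ → ℝ, Summable u ∧ ∀ k (z : ℂ), ‖z‖ ≤ R →
      ‖toComplex (opTrace (exteriorMap k A)) * z ^ k‖ ≤ u k := by
  obtain ⟨T, hT, h⟩ := hA.exists_norm_le
  refine ⟨fun k => (T * R) ^ k / k.factorial, Real.summable_pow_div_factorial _, fun k z hz => ?_⟩
  rw [norm_mul, norm_toComplex, norm_pow]
  calc ‖opTrace (exteriorMap k A)‖ * ‖z‖ ^ k ≤ T ^ k / k.factorial * R ^ k := by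
        gcongr
        exact h k
    _ = (T * R) ^ k / k.factorial := by rw [mul_pow, mul_div_right_comm]

theorem IsNuclear.summable_fredholmDet {A : H →L[𝕜] H} (hA : IsNuclear A) (z : ℂ) :
    Summable fun k : ℕ => toComplex (opTrace (exteriorMap k A)) * z ^ k := by
  obtain ⟨u, hu, h⟩ := hA.exists_summable_bound ‖z‖
  exact Summable.of_norm_bounded hu fun k => h k z le_rfl

theorem IsNuclear.differentiable_fredholmDet {A : H →L[𝕜] H} (hA : IsNuclear A) :
    Differentiable ℂ (fredholmDet A) := by
  intro z
  obtain ⟨u, hu, h⟩ := hA.exists_summable_bound (‖z‖ + 1)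
  have hd : DifferentiableOn ℂ (fredholmDet A) (Metric.ball 0 (‖z‖ + 1)) := by
    refine Complex.differentiableOn_tsum_of_summable_norm hu (fun k => by fun_prop)
      Metric.isOpen_ball fun k w hw => h k w ?_
    simpa using (Metric.mem_ball.1 hw).le
  exact hd.differentiableAt (Metric.isOpen_ball.mem_nhds (by simp))

theorem IsNuclear.fredholmDet_zero {A : H →L[𝕜] H} (hA : IsNuclear A) : fredholmDet A 0 = 1 := by
  rw [fredholmDet, tsum_eq_single 0 fun k hk => by simp [hk], hA.opTrace_exteriorMap_zero]
  simp

theorem IsNuclear.fredholmDet_split_eigenvector {B : H →L[𝕜] H} (hB : IsNuclear B) {v : H}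
    (hv : ‖v‖ = 1) {μ : 𝕜} (hBv : B v = μ • v) (z : ℂ) :
    fredholmDet B z = (1 + toComplex μ * z) * fredholmDet (deflate v ∘L B ∘L deflate v) z := by
  obtain ⟨hB', hrec⟩ := hB.split_eigenvector hv hBv
  have hs := hB'.summable_fredholmDet z
  rw [fredholmDet, (hB.summable_fredholmDet z).tsum_eq_zero_add, add_mul, one_mul, mul_assoc]
  conv_rhs =>
    rw [fredholmDet, ← tsum_mul_left, ← tsum_mul_left, hs.tsum_eq_zero_add]
  rw [hB.opTrace_exteriorMap_zero, hB'.opTrace_exteriorMap_zero, add_assoc,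
    ← ((summable_nat_add_iff 1).2 hs).tsum_add ((hs.mul_left z).mul_left _)]
  congr 1
  refine tsum_congr fun k => ?_
  rw [hrec, map_add, map_mul]
  ring

/-- The determinant of `A` is that of the triangular matrix on `W` times that of the compression
of `A` to the orthogonal complement of `W`; `R` is the orthogonal projection onto that
complement. -/
theorem EigenFlag.exists_compression {A : H →L[𝕜] H} (hA : IsNuclear A) {L : List 𝕜}
    {W : Submodule 𝕜 H} (h : EigenFlag A L W) :
    ∃ R : H →L[𝕜] H, (∀ w ∈ W, R w = 0) ∧ (∀ x, x - R x ∈ W) ∧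
      (∀ x, ∀ w ∈ W, inner 𝕜 w (R x) = 0) ∧ IsNuclear (R ∘L A ∘L R) ∧
      ∀ z, fredholmDet A z =
        (L.map fun μ => 1 + toComplex μ * z).prod * fredholmDet (R ∘L A ∘L R) z := by
  induction h with
  | nil =>
    exact ⟨ContinuousLinearMap.id 𝕜 H, by simp, by simp, by simp, hA, fun z => by simp⟩
  | @cons L W μ v hW hv hAv ih =>
    obtain ⟨R, hR0, hR1, hR2, hRn, hRd⟩ := ih
    have hRR : ∀ x, R (R x) = R x := fun x => by
      have := hR0 _ (hR1 x)
      rw [map_sub, sub_eq_zero] at this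
      exact this.symm
    have hu0 : R v ≠ 0 := fun h0 => hv (by simpa [h0] using hR1 v)
    -- The normalized component `e` of `v` orthogonal to `W` is an eigenvector of `R A R`.
    set e : H := ((‖R v‖⁻¹ : ℝ) : 𝕜) • R v with he
    have he1 : ‖e‖ = 1 := by
      have : ‖R v‖ ≠ 0 := by simpa using hu0
      simp [he, norm_smul, inv_mul_cancel₀ this]
    have hRe : R e = e := by rw [he, map_smul, hRR]
    have hRv : R v = ((‖R v‖ : ℝ) : 𝕜) • e := by
      have : ((‖R v‖ : ℝ) : 𝕜) ≠ 0 := by simpa using hu0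
      rw [he, smul_smul, RCLike.ofReal_inv, mul_inv_cancel₀ this, one_smul]
    have heW : ∀ w ∈ W, inner 𝕜 w e = 0 := fun w hw => by rw [← hRe]; exact hR2 e w hw
    have heig : (R ∘L A ∘L R) e = μ • e := by
      have h1 : R (A (R v)) = μ • R v := by
        have h2 := hR0 _ hAv
        have h3 := hR0 _ (hW.map_mem (hR1 v))
        rw [map_sub, map_smul, sub_eq_zero] at h2
        rw [map_sub, map_sub, sub_eq_zero] at h3
        rw [← h3, h2]
      rw [ContinuousLinearMap.comp_apply, ContinuousLinearMap.comp_apply, hRe]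
      conv_lhs => rw [he, map_smul, map_smul, h1]
      rw [smul_comm]
    have hcomm : ∀ x, R (deflate (𝕜 := 𝕜) e x) = deflate (𝕜 := 𝕜) e (R x) := by
      intro x
      rw [deflate_apply, deflate_apply, map_sub, map_smul, hRe]
      have h1 : inner 𝕜 e (x - R x) = 0 := by
        rw [← inner_conj_symm, heW _ (hR1 x), map_zero]
      rw [inner_sub_right, sub_eq_zero] at h1
      rw [h1]
    have hop : (deflate e ∘L R) ∘L A ∘L (deflate e ∘L R) =
        deflate e ∘L (R ∘L A ∘L R) ∘L deflate e := by
      ext x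
      simp [hcomm]
    have hdR : ∀ w ∈ W, deflate (𝕜 := 𝕜) e (R w) = 0 := fun w hw => by rw [hR0 w hw, map_zero]
    have hdv : deflate (𝕜 := 𝕜) e (R v) = 0 := by
      rw [hRv, map_smul, deflate_apply, inner_self_eq_norm_sq_to_K, he1]
      simp
    have heWv : e ∈ W ⊔ Submodule.span 𝕜 {v} := by
      have h1 : R v ∈ W ⊔ Submodule.span 𝕜 {v} := by
        have h2 := sub_mem (Submodule.mem_sup_right (S := W) (Submodule.mem_span_singleton_self v))
          (Submodule.mem_sup_left (T := Submodule.span 𝕜 {v}) (hR1 v))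
        simpa using h2
      exact Submodule.smul_mem _ _ h1
    have hortho : ∀ x, ∀ w ∈ W, inner 𝕜 w (deflate (𝕜 := 𝕜) e (R x)) = 0 := by
      intro x w hw
      rw [deflate_apply, inner_sub_right, inner_smul_right, hR2 x w hw, heW w hw]
      simp
    refine ⟨deflate e ∘L R, ?_, fun x => ?_, fun x => ?_, ?_, fun z => ?_⟩
    · intro w hw
      obtain ⟨a, ha, b, hb, rfl⟩ := Submodule.mem_sup.1 hw
      obtain ⟨c, rfl⟩ := Submodule.mem_span_singleton.1 hb
      simp [hdR a ha, hdv]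
    · rw [ContinuousLinearMap.comp_apply, deflate_apply, sub_sub_eq_add_sub, add_sub_right_comm]
      exact add_mem (Submodule.mem_sup_left (hR1 x)) (Submodule.smul_mem _ _ heWv)
    · intro w hw
      obtain ⟨a, ha, b, hb, rfl⟩ := Submodule.mem_sup.1 hw
      obtain ⟨c, rfl⟩ := Submodule.mem_span_singleton.1 hb
      have h1 : inner 𝕜 v (deflate (𝕜 := 𝕜) e (R x)) = 0 := by
        have h2 := hortho x _ (hR1 v)
        rw [inner_sub_left, hRv, inner_smul_left, inner_deflate_right_eq_zero he1, mul_zero,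
          sub_zero] at h2
        exact h2
      simp [inner_add_left, inner_smul_left, hortho x a ha, h1]
    · rw [hop]
      exact (hRn.split_eigenvector he1 heig).1
    · rw [hop, hRd, hRn.fredholmDet_split_eigenvector he1 heig, List.map_cons, List.prod_cons]
      ring

end Determinant

/-! ### Zeros and growth of entire functions -/

/-- A form of Jensen's inequality. On the circle `‖z‖ = R` the factor `1 + μ z` has the absolute
value of `(z + conj μ R²) / R`; replacing all these factors leaves the maximum on the circle
unchanged and turns the value at `0` into the product on the left. -/
theorem prod_mul_norm_le_of_factorization {g : ℂ → ℂ} (hg : Differentiable ℂ g) (hg0 : g 0 = 1)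
    (L : List ℂ) {R M : ℝ} (hR : 0 < R)
    (hM : ∀ z : ℂ, ‖z‖ = R → ‖(L.map fun μ => 1 + μ * z).prod * g z‖ ≤ M) :
    (L.map fun μ => R * ‖μ‖).prod ≤ M := by
  set q : List ℂ → ℂ → ℂ := fun L z => (L.map fun μ => (z + conj μ * R ^ 2) / R).prod with hq
  have hR' : (R : ℂ) ≠ 0 := by exact_mod_cast hR.ne'
  have hqd : ∀ L, Differentiable ℂ (q L) := by
    intro L
    induction L with
    | nil => simp [hq]
    | cons μ L ih =>
      have : q (μ :: L) = fun z => (z + conj μ * R ^ 2) / R * q L z := by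
        ext z; simp [hq]
      rw [this]
      fun_prop
  have hq0 : ∀ L, ‖q L 0‖ = (L.map fun μ => R * ‖μ‖).prod := by
    intro L
    induction L with
    | nil => simp [hq]
    | cons μ L ih =>
      have : q (μ :: L) 0 = (0 + conj μ * R ^ 2) / R * q L 0 := by simp [hq]
      rw [this, norm_mul, ih, List.map_cons, List.prod_cons]
      congr 1
      rw [zero_add, sq, ← mul_assoc, mul_div_assoc, div_self hR', mul_one, norm_mul,
        RCLike.norm_conj, Complex.norm_real, Real.norm_of_nonneg hR.le, mul_comm]
  have hqR : ∀ L (z : ℂ), ‖z‖ = R → ‖q L z‖ = ‖(L.map fun μ => 1 + μ * z).prod‖ := by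
    intro L z hz
    induction L with
    | nil => simp [hq]
    | cons μ L ih =>
      have : q (μ :: L) z = (z + conj μ * R ^ 2) / R * q L z := by simp [hq]
      rw [this, norm_mul, ih, List.map_cons, List.prod_cons, norm_mul]
      congr 1
      have h1 : z + conj μ * R ^ 2 = z * conj (1 + μ * z) := by
        have : (R : ℂ) ^ 2 = z * conj z := by
          rw [Complex.mul_conj, Complex.normSq_eq_norm_sq, hz]; push_cast; rfl
        rw [this]
        simp
        ring
      rw [h1, norm_div, norm_mul, RCLike.norm_conj, hz, Complex.norm_real,
        Real.norm_of_nonneg hR.le, mul_div_assoc, mul_div_cancel₀ _ hR.ne']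
  have hmax : ‖q L 0 * g 0‖ ≤ M := by
    refine Complex.norm_le_of_forall_mem_frontier_norm_le (f := fun z => q L z * g z)
      (U := Metric.ball 0 R) Metric.isBounded_ball ((hqd L).mul hg).diffContOnCl ?_
      (subset_closure (by simpa using hR))
    intro z hz
    rw [frontier_ball _ hR.ne'] at hz
    have hz' : ‖z‖ = R := by simpa using hz
    rw [norm_mul, hqR L z hz', ← norm_mul]
    exact hM z hz'
  rwa [hg0, mul_one, hq0] at hmax

theorem pow_le_pow_self_mul_exp {x : ℝ} (hx : 0 ≤ x) (k : ℕ) :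
    x ^ k ≤ (k : ℝ) ^ k * Real.exp x := by
  have h1 := Real.pow_div_factorial_le_exp x hx k
  rw [div_le_iff₀ (by positivity)] at h1
  refine h1.trans ?_
  rw [mul_comm]
  gcongr
  exact_mod_cast k.factorial_le_pow

/-- Power series with coefficients of size `k ^ (-k / t)` have order at most `t`. -/
theorem norm_tsum_le_of_coeff_le {c : ℕ → ℂ} {C t : ℝ} (ht : 0 < t)
    (hc : ∀ k : ℕ, ‖c k‖ ≤ C * (k : ℝ) ^ (-(k : ℝ) / t)) (z : ℂ) :
    ‖∑' k, c k * z ^ k‖ ≤ 2 * C * Real.exp ((2 * ‖z‖) ^ t / t) := by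
  have hC : 0 ≤ C := by
    have := (norm_nonneg _).trans (hc 0)
    simpa using this
  set E := Real.exp ((2 * ‖z‖) ^ t / t) with hE
  -- Bounding the terms at `2 ‖z‖` instead of `‖z‖` leaves a geometric factor `2 ^ (-k)`.
  have key : ∀ k : ℕ, ‖c k * z ^ k‖ ≤ C * E * (1 / 2) ^ k := by
    intro k
    have h1 : (2 * ‖z‖) ^ k ≤ (k : ℝ) ^ ((k : ℝ) / t) * E := by
      have h2 := pow_le_pow_self_mul_exp (x := (2 * ‖z‖) ^ t) (by positivity) k
      have h3 := Real.rpow_le_rpow (by positivity) h2 (inv_nonneg.2 ht.le)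
      rw [Real.mul_rpow (by positivity) (Real.exp_pos _).le, ← Real.rpow_natCast,
        ← Real.rpow_natCast, ← Real.rpow_mul (by positivity), ← Real.rpow_mul (by positivity),
        ← Real.rpow_mul (by positivity), ← Real.exp_mul] at h3
      rw [mul_left_comm, mul_inv_cancel₀ ht.ne', mul_one, Real.rpow_natCast] at h3
      simpa only [div_eq_mul_inv, hE] using h3
    have h4 : (k : ℝ) ^ (-(k : ℝ) / t) * (k : ℝ) ^ ((k : ℝ) / t) = 1 := by
      rcases Nat.eq_zero_or_pos k with rfl | hk
      · simp
      · rw [← Real.rpow_add (by exact_mod_cast hk), neg_div, neg_add_cancel, Real.rpow_zero]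
    have h5 : ‖z‖ ^ k = (1 / 2) ^ k * (2 * ‖z‖) ^ k := by
      rw [← mul_pow]; congr 1; ring
    calc ‖c k * z ^ k‖ = ‖c k‖ * ‖z‖ ^ k := by rw [norm_mul, norm_pow]
      _ ≤ (C * (k : ℝ) ^ (-(k : ℝ) / t)) * ((1 / 2) ^ k * ((k : ℝ) ^ ((k : ℝ) / t) * E)) := by
          rw [h5]
          gcongr
          exact hc k
      _ = C * E * (1 / 2) ^ k * ((k : ℝ) ^ (-(k : ℝ) / t) * (k : ℝ) ^ ((k : ℝ) / t)) := by ring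
      _ = C * E * (1 / 2) ^ k := by rw [h4, mul_one]
  have := tsum_of_norm_bounded (hasSum_geometric_two.mul_left (C * E)) key
  linarith

/-! ### Orders and convergence exponents -/

theorem exists_coeff_le_of_coeffOrder_lt {𝕜 : Type*} [RCLike 𝕜] {a : ℕ → 𝕜} {T s : ℝ}
    (ha : ∀ k, ‖a k‖ ≤ T ^ k / k.factorial) (hs : coeffOrder a < (s : EReal)) :
    ∃ t, 0 < t ∧ t < s ∧ ∃ C, ∀ k : ℕ, ‖a k‖ ≤ C * (k : ℝ) ^ (-(k : ℝ) / t) := by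
  obtain ⟨t, hat, hts⟩ := EReal.lt_iff_exists_real_btwn.1 hs
  have hlt := eventually_lt_of_limsup_lt hat
  have h1 : ∀ᶠ k : ℕ in atTop, ‖a k‖ < 1 :=
    ((FloorSemiring.tendsto_pow_div_factorial_atTop T).eventually_lt_const one_pos).mono
      fun k hk => (ha k).trans_lt hk
  have hev : ∀ᶠ k : ℕ in atTop, 1 ≤ k ∧ ‖a k‖ < 1 ∧
      (k : ℝ) * Real.log k / (-Real.log ‖a k‖) < t := by
    filter_upwards [hlt, h1, eventually_ge_atTop 1] with k hk hk1 hk2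
    exact ⟨hk2, hk1, EReal.coe_lt_coe_iff.1 hk⟩
  -- The quotients are eventually nonnegative, so `t` is positive.
  have ht : 0 < t := by
    obtain ⟨k, hk1, hk2, hk3⟩ := hev.exists
    have h2 : Real.log ‖a k‖ ≤ 0 := Real.log_nonpos (norm_nonneg _) hk2.le
    have h3 : 0 ≤ Real.log k := Real.log_natCast_nonneg k
    exact lt_of_le_of_lt (div_nonneg (by positivity) (by linarith)) hk3
  refine ⟨t, ht, EReal.coe_lt_coe_iff.1 hts, ?_⟩
  have hpos : ∀ k : ℕ, 0 < (k : ℝ) ^ (-(k : ℝ) / t) := by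
    intro k
    rcases Nat.eq_zero_or_pos k with rfl | hk
    · simp
    · exact Real.rpow_pos_of_pos (by exact_mod_cast hk) _
  obtain ⟨N, hN⟩ := eventually_atTop.1 hev
  have hsum : ∀ k, 0 ≤ ‖a k‖ / (k : ℝ) ^ (-(k : ℝ) / t) := fun k =>
    div_nonneg (norm_nonneg _) (hpos k).le
  refine ⟨1 + ∑ k ∈ Finset.range N, ‖a k‖ / (k : ℝ) ^ (-(k : ℝ) / t), fun k => ?_⟩
  rw [← div_le_iff₀ (hpos k)]
  rcases lt_or_ge k N with hk | hk
  · have := Finset.single_le_sum (fun i _ => hsum i) (Finset.mem_range.2 hk)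
    linarith
  · refine le_trans ?_ (le_add_of_nonneg_right (Finset.sum_nonneg fun i _ => hsum i))
    rw [div_le_one (hpos k)]
    obtain ⟨hk1, hk2, hk3⟩ := hN k hk
    rcases (norm_nonneg (a k)).eq_or_lt with h0 | h0
    · rw [← h0]; exact (hpos k).le
    · have hlog : 0 < -Real.log ‖a k‖ := neg_pos.2 (Real.log_neg h0 hk2)
      rw [div_lt_iff₀ hlog] at hk3
      have hk0 : (0 : ℝ) < k := by exact_mod_cast hk1
      rw [Real.rpow_def_of_pos hk0, ← Real.log_le_iff_le_exp h0, mul_div_assoc', le_div_iff₀ ht]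
      linarith

/-- A counting function of growth `r ^ t` gives convergence exponent at most `t`: the points with
`r₀ 2 ^ j ≤ ν x < r₀ 2 ^ (j + 1)` contribute at most a multiple of `2 ^ (j (t - s))`. -/
theorem summable_of_counting {X : Type*} {m ν : X → ℝ} (hm : ∀ x, 0 ≤ m x) {r₀ s t K : ℝ}
    (hr₀ : 0 < r₀) (hν : ∀ x, r₀ ≤ ν x) (ht : 0 < t) (hts : t < s)
    (hK : ∀ r, 0 < r → ∀ F : Finset X, (∀ x ∈ F, ν x ≤ r) → ∑ x ∈ F, m x ≤ K * (1 + r ^ t)) :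
    Summable fun x => m x * (1 / ν x ^ s) := by
  classical
  have hs : 0 < s := ht.trans hts
  have hex : ∀ x, ∃ j : ℕ, (2 : ℝ) ^ j ≤ ν x / r₀ ∧ ν x / r₀ < 2 ^ (j + 1) := fun x =>
    exists_nat_pow_near ((one_le_div hr₀).2 (hν x)) one_lt_two
  choose j hj1 hj2 using hex
  have hK0 : 0 ≤ K := by
    have := hK 1 one_pos ∅ (by simp)
    norm_num at this
    linarith
  set c : ℕ → ℝ := fun i => (r₀ ^ s)⁻¹ * ((2 : ℝ) ^ (-s)) ^ i * (K * (1 + (r₀ * 2 ^ (i + 1)) ^ t))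
    with hc
  have hc0 : ∀ i, 0 ≤ c i := fun i => by positivity
  have hcs : Summable c := by
    have e : c = fun i => (r₀ ^ s)⁻¹ * K * ((2 : ℝ) ^ (-s)) ^ i +
        (r₀ ^ s)⁻¹ * K * (r₀ * 2) ^ t * ((2 : ℝ) ^ (t - s)) ^ i := by
      ext i
      have h1 : (r₀ * 2 ^ (i + 1)) ^ t = (r₀ * 2) ^ t * ((2 : ℝ) ^ t) ^ i := by
        rw [pow_succ', ← mul_assoc, Real.mul_rpow (by positivity) (by positivity),
          ← Real.rpow_natCast 2 i, ← Real.rpow_natCast (2 ^ t) i, ← Real.rpow_mul (by norm_num),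
          ← Real.rpow_mul (by norm_num), mul_comm t]
      have h2 : (2 : ℝ) ^ (t - s) = 2 ^ (-s) * 2 ^ t := by
        rw [← Real.rpow_add (by norm_num)]; congr 1; ring
      simp only [hc]
      rw [h1, h2, mul_pow]
      ring
    rw [e]
    refine Summable.add (Summable.mul_left _ (summable_geometric_of_lt_one (by positivity) ?_))
      (Summable.mul_left _ (summable_geometric_of_lt_one (by positivity) ?_))
    · exact Real.rpow_lt_one_of_one_lt_of_neg one_lt_two (by linarith)
    · exact Real.rpow_lt_one_of_one_lt_of_neg one_lt_two (by linarith)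
  refine summable_of_sum_le (c := ∑' i, c i) (fun x => ?_) fun F => ?_
  · have := hr₀.trans_le (hν x)
    have := hm x
    positivity
  · have hterm : ∀ x, m x * (1 / ν x ^ s) ≤ m x * ((r₀ ^ s)⁻¹ * ((2 : ℝ) ^ (-s)) ^ j x) := by
      intro x
      refine mul_le_mul_of_nonneg_left ?_ (hm x)
      have h1 : r₀ * 2 ^ j x ≤ ν x := by
        have := hj1 x
        rwa [le_div_iff₀ hr₀, mul_comm] at this
      have h2 : (r₀ ^ s)⁻¹ * ((2 : ℝ) ^ (-s)) ^ j x = 1 / (r₀ * 2 ^ j x) ^ s := by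
        rw [Real.mul_rpow hr₀.le (by positivity), one_div, mul_inv, Real.rpow_neg (by norm_num),
          ← Real.rpow_natCast 2 (j x), ← Real.rpow_mul (by norm_num), mul_comm _ s,
          Real.rpow_mul (by norm_num), Real.rpow_natCast, inv_pow]
      rw [h2]
      gcongr
    calc ∑ x ∈ F, m x * (1 / ν x ^ s)
        ≤ ∑ x ∈ F, m x * ((r₀ ^ s)⁻¹ * ((2 : ℝ) ^ (-s)) ^ j x) :=
          Finset.sum_le_sum fun x _ => hterm x
      _ = ∑ i ∈ F.image j, ∑ x ∈ F with j x = i,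
            m x * ((r₀ ^ s)⁻¹ * ((2 : ℝ) ^ (-s)) ^ j x) :=
          (Finset.sum_fiberwise_of_maps_to (fun x hx => Finset.mem_image_of_mem j hx) _).symm
      _ ≤ ∑ i ∈ F.image j, c i := by
          refine Finset.sum_le_sum fun i _ => ?_
          have h1 : ∑ x ∈ F with j x = i, m x * ((r₀ ^ s)⁻¹ * ((2 : ℝ) ^ (-s)) ^ j x) =
              (r₀ ^ s)⁻¹ * ((2 : ℝ) ^ (-s)) ^ i * ∑ x ∈ F with j x = i, m x := by
            rw [Finset.mul_sum]
            refine Finset.sum_congr rfl fun x hx => ?_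
            rw [(Finset.mem_filter.1 hx).2]
            ring
          rw [h1]
          refine mul_le_mul_of_nonneg_left (hK _ (by positivity) _ fun x hx => ?_) (by positivity)
          have h2 := (hj2 x).le
          rwa [(Finset.mem_filter.1 hx).2, div_le_iff₀ hr₀, mul_comm] at h2
      _ ≤ ∑' i, c i := hcs.sum_le_tsum _ fun i _ => hc0 i

section Counting

variable {𝕜 : Type*} [RCLike 𝕜] {H : Type u} [NormedAddCommGroup H] [InnerProductSpace 𝕜 H]

/-! ### Flags of generalized eigenvectors -/

/-- A vector of the generalized eigenspace that lies outside of `W` yields one that extends the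
flag. -/
theorem EigenFlag.exists_extend {A : H →L[𝕜] H} {L : List 𝕜} {W : Submodule 𝕜 H}
    (h : EigenFlag A L W) {μ : 𝕜} (hE : ¬ genEigenspace A μ ≤ W) :
    ∃ W', W ≤ W' ∧ W' ≤ W ⊔ genEigenspace A μ ∧ EigenFlag A (μ :: L) W' := by
  classical
  obtain ⟨w, hwE, hwW⟩ := SetLike.not_le_iff_exists.1 hE
  set N : Module.End 𝕜 H := (A : H →ₗ[𝕜] H) - algebraMap 𝕜 (Module.End 𝕜 H) μ with hN
  have hNE : ∀ x ∈ genEigenspace A μ, N x ∈ genEigenspace A μ := fun x hx =>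
    sub_mem (Module.End.mapsTo_maxGenEigenspace_of_comm rfl μ hx) (Submodule.smul_mem _ _ hx)
  have hpow : ∀ n, (N ^ n) w ∈ genEigenspace A μ := by
    intro n
    induction n with
    | zero => simpa using hwE
    | succ n ih => rw [pow_succ', Module.End.mul_apply]; exact hNE _ ih
  have hex : ∃ n, (N ^ n) w ∈ W := by
    obtain ⟨n, hn⟩ := (Module.End.mem_maxGenEigenspace _ _ _).1 hwE
    exact ⟨n, by
      have : (N ^ n) w = 0 := hn
      rw [this]; exact W.zero_mem⟩
  -- The last vector of the chain `w, N w, N² w, …` outside `W` extends the flag.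
  obtain ⟨n, hn⟩ : ∃ n, Nat.find hex = n + 1 := by
    refine Nat.exists_eq_succ_of_ne_zero fun h0 => hwW ?_
    have := Nat.find_spec hex
    rw [h0] at this
    simpa using this
  have h1 : (N ^ n) w ∉ W := Nat.find_min hex (by omega)
  have h2 : A ((N ^ n) w) - μ • (N ^ n) w ∈ W := by
    have := Nat.find_spec hex
    rw [hn, pow_succ', Module.End.mul_apply] at this
    exact this
  refine ⟨_, le_sup_left, sup_le_sup_left ?_ _, h.cons μ _ h1 h2⟩
  rw [Submodule.span_singleton_le_iff_mem]
  exact hpow n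

/-- Either `n` further vectors of a generalized eigenspace can be appended to a flag, or fewer of
them exhaust the generalized eigenspace. -/
theorem EigenFlag.exists_replicate {A : H →L[𝕜] H} {L : List 𝕜} {W : Submodule 𝕜 H}
    (h : EigenFlag A L W) (μ : 𝕜) (n : ℕ) :
    (∃ W', W ≤ W' ∧ W' ≤ W ⊔ genEigenspace A μ ∧ EigenFlag A (List.replicate n μ ++ L) W') ∨
      ∃ j, EigenFlag A (List.replicate j μ ++ L) (W ⊔ genEigenspace A μ) := by
  induction n with
  | zero => exact Or.inl ⟨W, le_rfl, le_sup_left, by simpa using h⟩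
  | succ n ih =>
    rcases ih with ⟨W', h1, h2, h3⟩ | ih
    · by_cases hE : genEigenspace A μ ≤ W'
      · refine Or.inr ⟨n, ?_⟩
        rwa [le_antisymm (sup_le h1 hE) h2]
      · obtain ⟨W'', h4, h5, h6⟩ := h3.exists_extend hE
        exact Or.inl ⟨W'', h1.trans h4, h5.trans (sup_le h2 le_sup_right), h6⟩
    · exact Or.inr ih

theorem EigenFlag.sup_genEigenspace {A : H →L[𝕜] H} {L : List 𝕜} {W : Submodule 𝕜 H}
    (h : EigenFlag A L W) {μ : 𝕜} (hfin : FiniteDimensional 𝕜 (genEigenspace A μ))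
    (hd : Disjoint W (genEigenspace A μ)) :
    EigenFlag A (List.replicate (Module.finrank 𝕜 (genEigenspace A μ)) μ ++ L)
      (W ⊔ genEigenspace A μ) := by
  have := h.finiteDimensional
  have hrank := Submodule.finrank_sup_add_finrank_inf_eq W (genEigenspace A μ)
  rw [hd.eq_bot, finrank_bot, h.finrank_eq] at hrank
  rcases h.exists_replicate μ (Module.finrank 𝕜 (genEigenspace A μ) + 1) with
    ⟨W', -, h2, h3⟩ | ⟨j, hj⟩
  · have h4 := Submodule.finrank_mono h2
    rw [h3.finrank_eq] at h4
    simp only [List.length_append, List.length_replicate] at h4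
    omega
  · have h4 := hj.finrank_eq
    simp only [List.length_append, List.length_replicate] at h4
    rwa [show Module.finrank 𝕜 (genEigenspace A μ) = j by omega]

/-- The generalized eigenspaces are independent, so a flag can pass through one after the other,
with each eigenvalue repeated according to its algebraic multiplicity. -/
theorem exists_eigenFlag_of_finset {A : H →L[𝕜] H} (F : Finset 𝕜)
    (hfin : ∀ μ ∈ F, FiniteDimensional 𝕜 (genEigenspace A μ)) :
    ∃ L, EigenFlag A L (⨆ μ ∈ F, genEigenspace A μ) ∧ (∀ μ ∈ L, μ ∈ F) ∧
      L.length = ∑ μ ∈ F, Module.finrank 𝕜 (genEigenspace A μ) := by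
  classical
  induction F using Finset.induction_on with
  | empty => exact ⟨[], by simpa using EigenFlag.nil, by simp, by simp⟩
  | insert μ F hμ ih =>
    obtain ⟨L, hL, hLF, hlen⟩ := ih fun ν hν => hfin ν (Finset.mem_insert_of_mem hν)
    have hd : Disjoint (⨆ ν ∈ F, genEigenspace A ν) (genEigenspace A μ) :=
      ((Module.End.independent_maxGenEigenspace (A : H →ₗ[𝕜] H)).disjoint_biSup
        (y := (F : Set 𝕜)) (by simpa using hμ)).symm
    refine ⟨List.replicate (Module.finrank 𝕜 (genEigenspace A μ)) μ ++ L, ?_, ?_, ?_⟩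
    · rw [Finset.iSup_insert, sup_comm]
      exact hL.sup_genEigenspace (hfin μ (Finset.mem_insert_self _ _)) hd
    · intro ν hν
      rcases List.mem_append.1 hν with h | h
      · rw [List.eq_of_mem_replicate h]; exact Finset.mem_insert_self _ _
      · exact Finset.mem_insert_of_mem (hLF ν h)
    · rw [List.length_append, List.length_replicate, hlen, Finset.sum_insert hμ]

/-! ### Counting eigenvalues -/

variable [CompleteSpace H]

/-- The eigenvalues in a flag are zeros of the determinant, so their number is bounded in terms
of the growth of the determinant. -/
theorem EigenFlag.two_pow_length_le {A : H →L[𝕜] H} (hA : IsNuclear A) {L : List 𝕜}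
    {W : Submodule 𝕜 H} (h : EigenFlag A L W) {r M : ℝ} (hr : 0 < r)
    (hL : ∀ μ ∈ L, r⁻¹ ≤ ‖μ‖) (hM : ∀ z : ℂ, ‖z‖ = 2 * r → ‖fredholmDet A z‖ ≤ M) :
    (2 : ℝ) ^ L.length ≤ M := by
  obtain ⟨R, -, -, -, hRn, hRd⟩ := h.exists_compression hA
  have h1 := prod_mul_norm_le_of_factorization hRn.differentiable_fredholmDet hRn.fredholmDet_zero
    (L.map toComplex) (R := 2 * r) (M := M) (by positivity) fun z hz => by
      have := hM z hz
      rw [hRd z] at this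
      simpa [Function.comp_def] using this
  refine le_trans ?_ h1
  clear h h1 hRd
  induction L with
  | nil => simp
  | cons μ L ih =>
    rw [List.length_cons, pow_succ', List.map_cons, List.map_cons, List.prod_cons, norm_toComplex]
    have h2 : 2 ≤ 2 * r * ‖μ‖ := by
      have h3 := hL μ (by simp)
      rw [inv_le_iff_one_le_mul₀ hr] at h3
      linarith
    exact mul_le_mul h2 (ih fun ν hν => hL ν (List.mem_cons_of_mem _ hν)) (by positivity)
      (by linarith)

/-- Flags with eigenvalues of absolute value at least `1 / r` have length `O(1 + r ^ t)`: on the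
circle of radius `2 r` the determinant is at most `2 C exp ((4 r) ^ t / t)`. -/
theorem exists_length_eigenFlag_le {A : H →L[𝕜] H} (hA : IsNuclear A) {C t : ℝ} (ht : 0 < t)
    (hC : ∀ k : ℕ, ‖opTrace (exteriorMap k A)‖ ≤ C * (k : ℝ) ^ (-(k : ℝ) / t)) :
    ∃ K : ℝ, ∀ r : ℝ, 0 < r → ∀ (L : List 𝕜) (W : Submodule 𝕜 H), EigenFlag A L W →
      (∀ μ ∈ L, r⁻¹ ≤ ‖μ‖) → (L.length : ℝ) ≤ K * (1 + r ^ t) := by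
  have hC1 : 1 ≤ C := by
    have := hC 0
    rw [hA.opTrace_exteriorMap_zero] at this
    simpa using this
  have hlog : 0 ≤ Real.log (2 * C) := Real.log_nonneg (by linarith)
  have h2 := Real.log_pos one_lt_two
  refine ⟨(Real.log (2 * C) + 4 ^ t / t) / Real.log 2, fun r hr L W h hL => ?_⟩
  have h1 := h.two_pow_length_le hA hr hL (M := 2 * C * Real.exp ((2 * (2 * r)) ^ t / t))
    fun z hz => by
      rw [← hz]
      exact norm_tsum_le_of_coeff_le ht (fun k => by rw [norm_toComplex]; exact hC k) z
  have h3 := Real.log_le_log (by positivity) h1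
  rw [Real.log_pow, Real.log_mul (by positivity) (Real.exp_pos _).ne', Real.log_exp] at h3
  have h4 : (2 * (2 * r)) ^ t = 4 ^ t * r ^ t := by
    rw [← Real.mul_rpow (by norm_num) hr.le]; congr 1; ring
  rw [h4] at h3
  rw [div_mul_eq_mul_div, le_div_iff₀ h2]
  have h5 : 0 ≤ Real.log (2 * C) * r ^ t := by positivity
  have h6 : 0 ≤ (4 : ℝ) ^ t / t := by positivity
  calc _ ≤ _ := h3
    _ ≤ _ := by rw [mul_div_right_comm]; linarith

end Counting

end HilbertExt

end

theorem mainTheorem8 {𝕜 : Type*} [RCLike 𝕜] {H : Type*} [NormedAddCommGroup H]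
    [InnerProductSpace 𝕜 H] [CompleteSpace H] [TopologicalSpace.SeparableSpace H]
    (A : H →L[𝕜] H) (hA : HilbertExt.IsTraceClass A) (s : ℝ)
    (hs : HilbertExt.coeffOrder
      (fun k => HilbertExt.opTrace (HilbertExt.exteriorMap k A)) < (s : EReal)) :
    (∀ z ∈ HilbertExt.charValues A, FiniteDimensional 𝕜 (HilbertExt.genEigenspace A z⁻¹)) ∧
    Summable (fun z : HilbertExt.charValues A =>
      (Module.finrank 𝕜 (HilbertExt.genEigenspace A (z : 𝕜)⁻¹) : ℝ) * (1 / ‖(z : 𝕜)‖ ^ s)) := by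
  classical
  have hN : HilbertExt.IsNuclear A := hA.isNuclear
  obtain ⟨T, -, hT⟩ := hN.exists_norm_le
  obtain ⟨t, ht, hts, C, hC⟩ := HilbertExt.exists_coeff_le_of_coeffOrder_lt hT hs
  obtain ⟨K, hK⟩ := HilbertExt.exists_length_eigenFlag_le hN ht hC
  have hfin : ∀ z ∈ HilbertExt.charValues A,
      FiniteDimensional 𝕜 (HilbertExt.genEigenspace A z⁻¹) := by
    intro z hz
    have hz0 : 0 < ‖z‖ := norm_pos_iff.2 hz.1
    -- A flag with `z⁻¹` repeated more than `K (1 + ‖z‖ ^ t)` times is impossible.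
    obtain ⟨n, hn⟩ := exists_nat_gt (K * (1 + ‖z‖ ^ t))
    rcases (HilbertExt.EigenFlag.nil (A := A)).exists_replicate z⁻¹ n with
      ⟨W, -, -, hW⟩ | ⟨j, hj⟩
    · have h1 := hK ‖z‖ hz0 _ _ hW fun μ hμ => by
        rw [List.append_nil] at hμ
        rw [List.eq_of_mem_replicate hμ, norm_inv]
      simp only [List.append_nil, List.length_replicate] at h1
      exact absurd hn h1.not_gt
    · have h1 := hj.finiteDimensional
      rwa [bot_sup_eq] at h1
  refine ⟨hfin, ?_⟩
  -- Since `‖z⁻¹‖ ≤ ‖A‖`, all `‖z‖` exceed `(‖A‖ + 1)⁻¹`, which makes sense also for `A = 0`.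
  refine HilbertExt.summable_of_counting (r₀ := (‖A‖ + 1)⁻¹) (K := K) (fun _ => Nat.cast_nonneg _)
    (by positivity) (fun z => ?_) ht hts fun r hr F hF => ?_
  · obtain ⟨z, hz0, hz⟩ := z
    obtain ⟨v, hv⟩ := hz.exists_hasEigenvector
    have h1 : A v = z⁻¹ • v := hv.apply_eq_smul
    have h2 := A.le_opNorm v
    rw [h1, norm_smul] at h2
    have h3 := le_of_mul_le_mul_right h2 (norm_pos_iff.2 hv.2)
    rw [norm_inv] at h3
    exact inv_le_of_inv_le₀ (norm_pos_iff.2 hz0) (by linarith)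
  · have hinj : Function.Injective fun z : HilbertExt.charValues A => (z : 𝕜)⁻¹ :=
      inv_injective.comp Subtype.val_injective
    obtain ⟨L, hL, hLF, hlen⟩ := HilbertExt.exists_eigenFlag_of_finset (A := A)
      (F.image fun z : HilbertExt.charValues A => (z : 𝕜)⁻¹) (by
        intro μ hμ
        obtain ⟨z, -, rfl⟩ := Finset.mem_image.1 hμ
        exact hfin z z.2)
    rw [Finset.sum_image fun x _ y _ h => hinj h] at hlen
    have h1 := hK r hr L _ hL fun μ hμ => by
      obtain ⟨z, hz, rfl⟩ := Finset.mem_image.1 (hLF μ hμ)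
      rw [norm_inv]
      exact inv_anti₀ (norm_pos_iff.2 z.2.1) (hF z hz)
    rw [hlen] at h1
    exact_mod_cast h1
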